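/- **Setting.** Let $I=[0,1]$ and let $d_I$ be a metric on $I$ inducing its usual topology. Let $\Omega=I^{\mathbb Z}$, $\theta\in(0,1)$, $d(x,y)=\sup_{k\in\mathbb Z}\theta^{|k|}d_I(x_k,y_k)$, and $\beta\in(0,1]$. Let $\tau:I\to I$ have $b$ full branches: there are $0=a_0<a_1<\dots<a_b=1$ and bijections (inverse branches) $\zeta_i:I\to[a_{i},a_{i+1}]$, $0\le i<b$, with $\tau(\zeta_i(x))=x$ for $x\in(0,1)$, such that every $y\in I$ equals $\zeta_i(\tau(y))$ for some $i$. Assume $\tau$ is expanding: for some $\eta\in(0,1)$, $d_I(\zeta_i x,\zeta_i y)\le\eta\, d_I(x,y)$ for all $i,x,y$. Fix a fixed point $p$ of $\tau$. Let $E:\Omega\to\Omega$ be a bijection and $0<C_E<\eta^{-1}$ with $d(\sigma^nE^{-1}x,\sigma^nE^{-1}y)\le C_E\,d(\sigma^nx,\sigma^ny)$ for all $n\in\mathbb Z$ and $x,y\in\Omega$, where $(\sigma^n x)_i=x_{i+n}$. For $k\in\mathbb N$ let $\pi_kx$ be the point with coordinates $x_j$ for $|j|\le k$ and $p$ for $|j|>k$.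 Set $$|\Phi|_\beta=\sup_k\sup_{x\ne y}\frac{|\Phi(\pi_kx)-\Phi(\pi_ky)|}{d(x,y)^\beta},$$ and let $\mathcal C$ be the space of continuous $\Phi$ on $\Omega$ (complex-valued, unless stated otherwise) with $|\Phi|_\beta<\infty$. Fix a real-valued potential $f\in\mathcal C$. Put $$P_k\Phi(x)=b^{-(2k+1)}\sum_{s\in\{0,\dots,b-1\}^{\{-k,\dots,k\}}}e^{f(x^s)}\Phi(x^s),\qquad P\Phi(x)=\lim_{k\to\infty}P_k\Phi(x),$$ where $x^s_j=\zeta_{s_j}(x_j)$ for $|j|\le k$ and $x^s_j=p$ for $|j|>k$. Call $(\lambda,\nu_0,h)$ *eigendata* if $\lambda\in\mathbb R$, $\nu_0$ is a Borel probability measure on $\Omega$ with $\int P\Phi\,d\nu_0=\lambda\int\Phi\,d\nu_0$ for all $\Phi\in\mathcal C$, and $h:\Omega\to[0,\infty)$ is continuous with $\int h\,d\nu_0=1$, $Ph=\lambda h$, and $$h(x)\le\exp\Big(|f|_\beta\tfrac{\eta^\beta}{1-\eta^\beta}d(x,y)^\beta\Big)h(y)\qquad(x,y\in\Omega).$$ For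 eigendata put $L\Phi=P(h\Phi)/(\lambda h)$ and $\mathcal L\Phi(x)=L\Phi(E^{-1}x)$. **Lemma.** The limit defining $P\Phi(x)$ exists for all $\Phi\in\mathcal C$ and $x\in\Omega$, and eigendata exist. For any eigendata, $\lambda>0$, $h>0$ everywhere, $\mathcal L$ maps $\mathcal C$ into $\mathcal C$, and the following hold. 1. $\mathcal L$ has a unique extension to a bounded linear operator on $C(\Omega)=C(\Omega,\mathbb C)$, still denoted $\mathcal L$. Its dual $\mathcal L^*$ on the space $\mathscr M(\Omega)$ of complex Radon measures is well defined: for every $\mu\in\mathscr M(\Omega)$ there is exactly one $\mathcal L^*\mu\in\mathscr M(\Omega)$ with $\int\varphi\,d(\mathcal L^*\mu)=\int\mathcal L\varphi\,d\mu$ for all $\varphi\in C(\Omega)$, and $\mathcal L^*$ is linear. 2. There is exactly one Borel probability measure $\nu$ on $\Omega$ with $\mathcal L^*\nu=\nu$. 3. $1$ is the only eigenvalue of modulus one of $\mathcal L:\mathcal C\to\mathcal C$ (and it is an eigenvalue). 4. For every $\psi\in\mathcal C$, $\mathcal L^n\psi\to\int\psi\,d\nu$ uniformly on $\Omega$ as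 $n\to\infty$. -/

import Mathlib

open MeasureTheory Filter Topology Set

/-- The lattice space `Ω = I^ℤ` over the unit interval `I = [0,1]`, with the product topology and the
product (equivalently Borel) `σ`-algebra. -/
abbrev LatticeSpace : Type := ℤ → unitInterval

/-- The shift `σⁿ` on `Ω`, for `n ∈ ℤ`: `(σⁿ x)_i = x_{i+n}`. -/
def latticeShift (n : ℤ) (x : LatticeSpace) : LatticeSpace := fun i => x (i + n)

/-- The metric `d(x, y) = sup_k θ^|k| d_I(x_k, y_k)` on `Ω`. -/
noncomputable def latticeDist (dI : unitInterval → unitInterval → ℝ) (θ : ℝ) (x y : LatticeSpace) : ℝ :=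
  ⨆ k : ℤ, θ ^ k.natAbs * dI (x k) (y k)

/-- The data and the standing assumptions of the coupled lattice map `T = E ∘ τ̄`. -/
structure CoupledLattice where
  /-- the metric `d_I` on the unit interval, compatible with its topology -/
  dI : unitInterval → unitInterval → ℝ
  dI_eq_zero : ∀ x y, dI x y = 0 ↔ x = y
  dI_symm : ∀ x y, dI x y = dI y x
  dI_triangle : ∀ x y z, dI x z ≤ dI x y + dI y z
  dI_basis : ∀ x, (𝓝 x).HasBasis (fun ε : ℝ => 0 < ε) (fun ε => {y | dI x y < ε})
  /-- the weight in the metric on `Ω` -/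
  θ : ℝ
  θ_mem : θ ∈ Ioo (0 : ℝ) 1
  /-- the Hölder exponent -/
  β : ℝ
  β_mem : β ∈ Ioc (0 : ℝ) 1
  /-- the single-site map, with `b` full branches: there is a partition `0 = a₀ < a₁ < ⋯ < a_b = 1`,
  and the closure of the branch of `τ` over `(aᵢ, aᵢ₊₁)` is the graph of the inverse of a bijection
  `ζᵢ : [0,1] → [aᵢ, aᵢ₊₁]` -/
  τ : unitInterval → unitInterval
  b : ℕ
  a : Fin (b + 1) → unitInterval
  a_strictMono : StrictMono a
  a_zero : a 0 = 0
  a_last : a (Fin.last b) = 1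
  /-- the inverse branches of `τ` -/
  ζ : Fin b → unitInterval → unitInterval
  ζ_bijOn : ∀ i, BijOn (ζ i) univ (Icc (a i.castSucc) (a i.succ))
  τ_ζ : ∀ i, ∀ x ∈ Ioo (0 : unitInterval) 1, τ (ζ i x) = x
  /-- at a point of the partition `τ` takes the value prescribed by one of the adjacent branches -/
  ζ_τ : ∀ y, ∃ i, ζ i (τ y) = y
  /-- `τ` is expanding -/
  η : ℝ
  η_mem : η ∈ Ioo (0 : ℝ) 1
  ζ_contract : ∀ i x y, dI (ζ i x) (ζ i y) ≤ η * dI x y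
  /-- the chosen fixed point of `τ` -/
  p : unitInterval
  τ_p : τ p = p
  /-- the coupling, an invertible map of `Ω` -/
  E : LatticeSpace ≃ LatticeSpace
  CE : ℝ
  CE_mem : CE ∈ Ioo (0 : ℝ) η⁻¹
  E_inv_lipschitz : ∀ (n : ℤ) (x y : LatticeSpace),
    latticeDist dI θ (latticeShift n (E.symm x)) (latticeShift n (E.symm y)) ≤
      CE * latticeDist dI θ (latticeShift n x) (latticeShift n y)

namespace CoupledLattice

noncomputable section

variable (S : CoupledLattice)

/-- The metric `d` on `Ω`. -/
def d (x y : LatticeSpace) : ℝ := latticeDist S.dI S.θ x y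

/-- `π_k x`: keep the coordinates with `|j| ≤ k`, put the fixed point `p` elsewhere. -/
def proj (k : ℕ) (x : LatticeSpace) : LatticeSpace := fun j => if j ∈ Finset.Icc (-(k : ℤ)) k then x j else S.p

/-- The quotients `|Φ_k(x) - Φ_k(y)| / d(x,y)^β`, with `Φ_k = Φ ∘ π_k` (and `0 / 0 = 0` on the
diagonal), whose supremum is the Hölder constant `|Φ|_β`. -/
def holderQuotient {F : Type*} [NormedAddCommGroup F] (Φ : LatticeSpace → F) (q : ℕ × LatticeSpace × LatticeSpace) : ℝ :=
  ‖Φ (S.proj q.1 q.2.1) - Φ (S.proj q.1 q.2.2)‖ / S.d q.2.1 q.2.2 ^ S.β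

/-- The Hölder constant `|Φ|_β = sup_k |Φ_k|_β` (meaningful when it is finite). -/
def holderConst {F : Type*} [NormedAddCommGroup F] (Φ : LatticeSpace → F) : ℝ := ⨆ q, S.holderQuotient Φ q

/-- Membership in the space `𝒞` of continuous functions on `Ω` with finite Hölder constant. -/
def InC {F : Type*} [NormedAddCommGroup F] (Φ : LatticeSpace → F) : Prop :=
  Continuous Φ ∧ BddAbove (range (S.holderQuotient Φ))

/-- `i_k ζ_x`, where the inverse branch `ζ` of `τ̄|Ω_k` is given by the choice `s` of an inverse
branch of `τ` at each site of `Λ_k = {-k, …, k}`. -/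
def branchPoint (k : ℕ) (s : Finset.Icc (-(k : ℤ)) k → Fin S.b) (x : LatticeSpace) : LatticeSpace :=
  fun j => if hj : j ∈ Finset.Icc (-(k : ℤ)) k then S.ζ (s ⟨j, hj⟩) (x j) else S.p

/-- The transfer operator `P_k` of the finite sublattice `Λ_k`, for the potential `f`. -/
def Pk (f : LatticeSpace → ℝ) (k : ℕ) (Φ : LatticeSpace → ℂ) (x : LatticeSpace) : ℂ :=
  ((S.b : ℂ) ^ (2 * k + 1))⁻¹ * ∑ s : Finset.Icc (-(k : ℤ)) k → Fin S.b,
    (Real.exp (f (S.branchPoint k s x)) : ℂ) * Φ (S.branchPoint k s x)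

/-- The transfer operator `P Φ (x) = lim_k P_k Φ (x)`. -/
def P (f : LatticeSpace → ℝ) (Φ : LatticeSpace → ℂ) (x : LatticeSpace) : ℂ :=
  limUnder atTop fun k => S.Pk f k Φ x

/-- The set `Δ_f` (relative to the probability measure `ν₀`): continuous `h ≥ 0` with `ν₀(h) = 1` and
`h(x) ≤ B(d(x,y)) h(y)`, where `B(z) = exp (|f|_β η^β / (1 - η^β) z^β)`. -/
def Delta (f : LatticeSpace → ℝ) (ν₀ : Measure LatticeSpace) : Set (LatticeSpace → ℝ) :=
  {h | Continuous h ∧ (∀ x, 0 ≤ h x) ∧ ∫ x, h x ∂ν₀ = 1 ∧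
    ∀ x y, h x ≤ Real.exp (S.holderConst f * (S.η ^ S.β / (1 - S.η ^ S.β)) * S.d x y ^ S.β) * h y}

/-- `ν₀` is a probability measure with `P^* ν₀ = lam ν₀`, and `h ∈ Δ_f` satisfies `P h = lam h`. -/
structure IsEigendata (f : LatticeSpace → ℝ) (lam : ℝ) (ν₀ : Measure LatticeSpace) (h : LatticeSpace → ℝ) : Prop where
  prob : IsProbabilityMeasure ν₀
  dual : ∀ Φ : LatticeSpace → ℂ, S.InC Φ → ∫ x, S.P f Φ x ∂ν₀ = lam * ∫ x, Φ x ∂ν₀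
  mem : h ∈ S.Delta f ν₀
  eigen : ∀ x, S.P f (fun y => (h y : ℂ)) x = lam * h x

/-- The normalized transfer operator `L Φ = P (h Φ) / (lam h)` of the uncoupled map. -/
def L (f : LatticeSpace → ℝ) (lam : ℝ) (h : LatticeSpace → ℝ) (Φ : LatticeSpace → ℂ) (x : LatticeSpace) : ℂ :=
  S.P f (fun y => (h y : ℂ) * Φ y) x / (lam * h x)

/-- The transfer operator `𝓛 Φ = (L Φ) ∘ E⁻¹` of the coupled map `T = E ∘ τ̄`. -/
def calL (f : LatticeSpace → ℝ) (lam : ℝ) (h : LatticeSpace → ℝ) (Φ : LatticeSpace → ℂ) (x : LatticeSpace) : ℂ :=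
  S.L f lam h Φ (S.E.symm x)

end

end CoupledLattice

/-- The integral `∫ φ dμ` of a complex function against a complex measure. On the compact metrizable
space `Ω` every complex Borel measure is Radon. -/
noncomputable def complexIntegral (μ : ComplexMeasure LatticeSpace) (φ : LatticeSpace → ℂ) : ℂ :=
  μ.integral φ (ContinuousLinearMap.mul ℝ ℂ)

/-- A probability measure on `Ω`, regarded as a complex measure. -/
noncomputable def probToComplex (ν : ProbabilityMeasure LatticeSpace) : ComplexMeasure LatticeSpace :=
  (ν : Measure LatticeSpace).toSignedMeasure.toComplexMeasure 0

/-! The proof is a cone argument for positive operators on $C(\Omega,\mathbb R)$. `logCone δ a`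
consists of the positive $\varphi$ for which $\log\varphi$ is $a$-Lipschitz with respect to
$\delta$, later $\delta=d^\beta$. If a positive operator $Q$ maps the cone of parameter $a$ into
that of a smaller parameter $a'$, then a definite proportion of $Q\psi$ can be subtracted from
$Q\varphi$ without leaving the cone of parameter $a$ (`exists_split`). Iterating, the ratios
$Q^n\varphi/Q^n\psi$ approach constants geometrically (`exists_ratio_bound`). Cone functions minus
constants are dense by Stone-Weierstrass, so $Q^n\varphi/Q^n1$ converges uniformly for every
continuous $\varphi$; the limit is a positive normalized functional, hence integration against a
probability measure (`exists_limit_measure`).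

This is applied twice. For $P$, the limit over $k$ exists because a continuous function almost
depends on finitely many coordinates, and averaging over branches at the other sites changes
nothing. Inverse branches contract $d$ by $\eta$, so $P$ sends parameter $a$ to
$(|f|_\beta+a)\eta^\beta$, a contraction with fixed point $B=|f|_\beta\eta^\beta/(1-\eta^\beta)$.
This yields $\lambda$, $\nu_0$ and $h$ (`exists_eigendata`), with $h$ in the closure of the cone of
parameter $B$.

For $\mathcal L$, multiplication by $h$ and by $1/(\lambda h)$ adds at most $2B$ to the parameter
and composition with $E^{-1}$ multiplies it by $C_E^\beta$. Since $C_E\eta<1$, every large $a$ is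
strictly decreased. As $\mathcal L1=1$, the ratios are the iterates themselves, so $\mathcal
L^n\varphi\to\int\varphi\,d\nu$ uniformly. Invariance and uniqueness of $\nu$ follow, and an
eigenfunction of modulus one must be constant, because iteration preserves its oscillation. Complex
functions are treated by real and imaginary parts, complex measures by Jordan decomposition. -/

theorem pow_succ_apply {E : Type*} [NormedAddCommGroup E] [NormedSpace ℝ E] (Q : E →L[ℝ] E)
    (n : ℕ) (x : E) : (Q ^ (n + 1)) x = (Q ^ n) (Q x) := by
  rw [pow_succ]; rfl

theorem pow_succ_apply' {E : Type*} [NormedAddCommGroup E] [NormedSpace ℝ E] (Q : E →L[ℝ] E)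
    (n : ℕ) (x : E) : (Q ^ (n + 1)) x = Q ((Q ^ n) x) := by
  rw [pow_succ']; rfl

/-! ### Cones of log-Hölder functions and their contraction. -/

section Cone

variable {X : Type*} [TopologicalSpace X]

/-- The cone of positive continuous functions `φ` with `φ x ≤ exp (a δ(x,y)) φ y`. -/
def logCone (δ : X → X → ℝ) (a : ℝ) : Set C(X, ℝ) :=
  {φ | (∀ x, 0 < φ x) ∧ ∀ x y, φ x ≤ Real.exp (a * δ x y) * φ y}

/-- A positive operator on `C(X, ℝ)` which maps `logCone δ a` to the smaller cone `logCone δ a'`. -/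
structure IsConeContraction [CompactSpace X] (δ : X → X → ℝ) (D a a' : ℝ)
    (Q : C(X, ℝ) →L[ℝ] C(X, ℝ)) : Prop where
  δ_nonneg : ∀ x y, 0 ≤ δ x y
  δ_le : ∀ x y, δ x y ≤ D
  δ_symm : ∀ x y, δ x y = δ y x
  nonneg : 0 ≤ a'
  lt : a' < a
  pos : ∀ φ : C(X, ℝ), (∀ x, 0 ≤ φ x) → ∀ x, 0 ≤ Q φ x
  maps : ∀ φ ∈ logCone δ a, Q φ ∈ logCone δ a'

theorem one_mem_logCone {δ : X → X → ℝ} (hδ : ∀ x y, 0 ≤ δ x y) {a : ℝ} (ha : 0 ≤ a) :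
    (1 : C(X, ℝ)) ∈ logCone δ a :=
  ⟨fun _ => by simp, fun x y => by simpa using mul_nonneg ha (hδ x y)⟩

theorem logCone_mono {δ : X → X → ℝ} (hδ : ∀ x y, 0 ≤ δ x y) {a a' : ℝ} (h : a' ≤ a) :
    logCone δ a' ⊆ logCone δ a := fun _ hφ =>
  ⟨hφ.1, fun x y => (hφ.2 x y).trans (mul_le_mul_of_nonneg_right
    (Real.exp_le_exp.2 (mul_le_mul_of_nonneg_right h (hδ x y))) (hφ.1 y).le)⟩

theorem smul_mem_logCone {δ : X → X → ℝ} {a c : ℝ} (hc : 0 < c) {φ : C(X, ℝ)}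
    (hφ : φ ∈ logCone δ a) : c • φ ∈ logCone δ a :=
  ⟨fun x => mul_pos hc (hφ.1 x), fun x y => by
    have := mul_le_mul_of_nonneg_left (hφ.2 x y) hc.le
    simp only [ContinuousMap.coe_smul, Pi.smul_apply, smul_eq_mul]
    linarith⟩

/-- The elementary inequality behind the contraction of the cones. -/
theorem exp_sub_exp_le {a a' D t : ℝ} (ha' : 0 ≤ a') (h : a' < a) (ht : 0 ≤ t) (htD : t ≤ D) :
    (a - a') / ((a + a') * Real.exp (a * D)) * (Real.exp (a * t) - Real.exp (-(a' * t))) ≤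
      Real.exp (a * t) - Real.exp (a' * t) := by
  have ha : 0 < a := ha'.trans_lt h
  have h1 : (a - a') * t ≤ Real.exp (a * t) - Real.exp (a' * t) := by
    have e : Real.exp (a * t) = Real.exp (a' * t) * Real.exp ((a - a') * t) := by
      rw [← Real.exp_add]; ring_nf
    have h2 := Real.add_one_le_exp ((a - a') * t)
    have h3 : 1 ≤ Real.exp (a' * t) := Real.one_le_exp (by positivity)
    have h4 : 0 ≤ (a - a') * t := mul_nonneg (by linarith) ht
    rw [e]
    nlinarith
  have h2 : Real.exp (a * t) - Real.exp (-(a' * t)) ≤ Real.exp (a * D) * ((a + a') * t) := by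
    have e : Real.exp (-(a' * t)) = Real.exp (a * t) * Real.exp (-((a + a') * t)) := by
      rw [← Real.exp_add]; ring_nf
    have h5 := Real.add_one_le_exp (-((a + a') * t))
    have h6 : Real.exp (a * t) ≤ Real.exp (a * D) := Real.exp_le_exp.2 (by gcongr)
    have h7 : 0 ≤ (a + a') * t := by positivity
    rw [e]
    have h8 := Real.exp_pos (a * t)
    nlinarith
  have hpos : 0 < (a + a') * Real.exp (a * D) := by positivity
  calc _ ≤ (a - a') / ((a + a') * Real.exp (a * D)) * (Real.exp (a * D) * ((a + a') * t)) :=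
        mul_le_mul_of_nonneg_left h2 (div_nonneg (by linarith) hpos.le)
    _ = (a - a') * t := by field_simp
    _ ≤ _ := h1

variable [CompactSpace X] {δ : X → X → ℝ} {D a a' : ℝ} {Q : C(X, ℝ) →L[ℝ] C(X, ℝ)}

namespace IsConeContraction

theorem apply_le (hQ : IsConeContraction δ D a a' Q) {φ : C(X, ℝ)} {c : ℝ} (hc : 0 ≤ c)
    (hφ : φ ∈ logCone δ c) (x y : X) : φ x ≤ Real.exp (c * D) * φ y :=
  (hφ.2 x y).trans (mul_le_mul_of_nonneg_right
    (Real.exp_le_exp.2 (mul_le_mul_of_nonneg_left (hQ.δ_le x y) hc)) (hφ.1 y).le)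

theorem mono (hQ : IsConeContraction δ D a a' Q) {φ ψ : C(X, ℝ)} (h : ∀ x, φ x ≤ ψ x) (x : X) :
    Q φ x ≤ Q ψ x := by
  have := hQ.pos (ψ - φ) (fun x => by simpa using h x) x
  simpa using this

theorem pow_pos' (hQ : IsConeContraction δ D a a' Q) (n : ℕ) {φ : C(X, ℝ)} (h : ∀ x, 0 ≤ φ x) :
    ∀ x, 0 ≤ (Q ^ n) φ x := by
  induction n with
  | zero => simpa using h
  | succ n ih => rw [pow_succ']; exact hQ.pos _ ih

theorem pow_mono (hQ : IsConeContraction δ D a a' Q) (n : ℕ) {φ ψ : C(X, ℝ)}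
    (h : ∀ x, φ x ≤ ψ x) (x : X) : (Q ^ n) φ x ≤ (Q ^ n) ψ x := by
  have := hQ.pow_pos' n (φ := ψ - φ) (fun x => by simpa using h x) x
  simpa using this

theorem pow_mem (hQ : IsConeContraction δ D a a' Q) (n : ℕ) {φ : C(X, ℝ)}
    (h : φ ∈ logCone δ a) : (Q ^ n) φ ∈ logCone δ a := by
  induction n with
  | zero => simpa using h
  | succ n ih => rw [pow_succ']; exact logCone_mono hQ.δ_nonneg hQ.lt.le (hQ.maps _ ih)

theorem pow_one_pos (hQ : IsConeContraction δ D a a' Q) (n : ℕ) (x : X) : 0 < (Q ^ n) 1 x :=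
  (hQ.pow_mem n (one_mem_logCone hQ.δ_nonneg (hQ.nonneg.trans hQ.lt.le))).1 x

/-- One step of the contraction: a definite proportion of `ψ` can be split off from `φ`. -/
theorem exists_split (hQ : IsConeContraction δ D a a' Q) :
    ∃ κ : ℝ, 0 ≤ κ ∧ κ < 1 ∧ ∀ φ ∈ logCone δ a', ∀ ψ ∈ logCone δ a', ∀ c : ℝ,
      (∀ x, φ x ≤ c * ψ x) → ∃ t : ℝ, 0 ≤ t ∧ φ - t • ψ ∈ logCone δ a ∧
        ∀ x, (φ - t • ψ) x ≤ c * κ * ψ x := by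
  have ha' := hQ.nonneg
  have hlt := hQ.lt
  have ha : 0 < a := ha'.trans_lt hlt
  set ε₀ : ℝ := (a - a') / ((a + a') * Real.exp (a * D)) with hε₀
  -- Halving `ε₀` gives `ε < 1` strictly, even when `D = 0` and `a' = 0`, so that `φ - t • ψ` stays
  -- strictly positive.
  set ε : ℝ := ε₀ / 2 with hε
  set K : ℝ := Real.exp (a' * D) with hK
  have hKpos : 0 < K := Real.exp_pos _
  by_cases hX : IsEmpty X
  · exact ⟨0, le_rfl, one_pos, fun φ _ ψ _ c _ => ⟨0, le_rfl, ⟨fun x => hX.elim x,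
      fun x => hX.elim x⟩, fun x => hX.elim x⟩⟩
  obtain ⟨x₀⟩ := not_isEmpty_iff.1 hX
  have hD : 0 ≤ D := (hQ.δ_nonneg x₀ x₀).trans (hQ.δ_le x₀ x₀)
  have hε0 : 0 < ε := half_pos (div_pos (by linarith) (by positivity))
  have hK1 : 1 ≤ K := Real.one_le_exp (by positivity)
  have hε1 : ε < 1 := by
    have : ε₀ ≤ 1 := by
      rw [hε₀, div_le_one (by positivity)]
      have : 1 ≤ Real.exp (a * D) := Real.one_le_exp (by positivity)
      nlinarith
    linarith
  have hεK : ε / K ^ 4 ≤ 1 := by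
    rw [div_le_one (by positivity)]
    exact hε1.le.trans (one_le_pow₀ hK1)
  refine ⟨1 - ε / K ^ 4, by linarith, by have := div_pos hε0 (pow_pos hKpos 4); linarith, ?_⟩
  intro φ hφ ψ hψ c hc
  have pφ := hφ.1
  have pψ := hψ.1
  have bφ := fun x y => hQ.apply_le ha' hφ x y
  have bψ := fun x y => hQ.apply_le ha' hψ x y
  set r := φ x₀ / ψ x₀ with hr
  have hr0 : 0 < r := div_pos (pφ x₀) (pψ x₀)
  have hr' : r * ψ x₀ = φ x₀ := div_mul_cancel₀ _ (pψ x₀).ne'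
  have up : ∀ y, φ y ≤ K ^ 2 * r * ψ y := fun y => by
    calc φ y ≤ K * φ x₀ := bφ y x₀
      _ = K * r * ψ x₀ := by rw [← hr']; ring
      _ ≤ K * r * (K * ψ y) := by gcongr; exact bψ x₀ y
      _ = _ := by ring
  have lo : ∀ y, r * ψ y ≤ K ^ 2 * φ y := fun y => by
    calc r * ψ y ≤ r * (K * ψ x₀) := by gcongr; exact bψ y x₀
      _ = K * φ x₀ := by rw [← hr']; ring
      _ ≤ K * (K * φ y) := by gcongr; exact bφ x₀ y
      _ = _ := by ring
  -- The ratio `φ / ψ` lies between `r / K ^ 2` and `K ^ 2 * r`, so this `t` gives `ε / K ^ 4 * φ ≤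
  -- t * ψ ≤ ε * φ`. The upper bound keeps the difference in the cone, the lower one produces `κ`.
  set t := ε * (r / K ^ 2) with ht
  have ht0 : 0 < t := by positivity
  have htψ : ∀ y, t * ψ y ≤ ε * φ y := fun y => by
    have : r / K ^ 2 * ψ y ≤ φ y := by
      rw [div_mul_eq_mul_div, div_le_iff₀ (by positivity)]; linarith [lo y]
    rw [ht, mul_assoc]; gcongr
  have up' : ∀ y, ε / K ^ 4 * φ y ≤ t * ψ y := fun y => by
    calc ε / K ^ 4 * φ y ≤ ε / K ^ 4 * (K ^ 2 * r * ψ y) := by gcongr; exact up y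
      _ = t * ψ y := by rw [ht]; field_simp
  have hb : ∀ y, (φ - t • ψ) y ≤ (1 - ε / K ^ 4) * φ y := fun y => by
    have := up' y
    simp only [ContinuousMap.sub_apply, ContinuousMap.smul_apply, smul_eq_mul]
    linarith
  refine ⟨t, ht0.le, ⟨fun y => ?_, fun x y => ?_⟩, fun y => ?_⟩
  · have := htψ y
    have := pφ y
    simp only [ContinuousMap.sub_apply, ContinuousMap.smul_apply, smul_eq_mul]
    nlinarith
  -- The claim amounts to `t * (exp (a δ) * ψ y - ψ x) ≤ exp (a δ) * φ y - φ x`. The cone conditions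
  -- of parameter `a'` for `ψ` and `φ` reduce it to `exp_sub_exp_le`.
  · have hd := hQ.δ_nonneg x y
    have h1 := hφ.2 x y
    have h2 := hψ.2 y x
    rw [hQ.δ_symm y x] at h2
    have h3 := exp_sub_exp_le ha' hlt hd (hQ.δ_le x y)
    have h4 : Real.exp (-(a' * δ x y)) * ψ y ≤ ψ x := by
      rw [Real.exp_neg, inv_mul_le_iff₀ (Real.exp_pos _)]; exact h2
    have h5 : 0 ≤ Real.exp (a * δ x y) - Real.exp (-(a' * δ x y)) := by
      have := Real.exp_le_exp.2 (show -(a' * δ x y) ≤ a * δ x y by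
        have : 0 ≤ a * δ x y := by positivity
        have : 0 ≤ a' * δ x y := by positivity
        linarith)
      linarith
    have h6 := mul_le_mul_of_nonneg_right (htψ y) h5
    have h7 := mul_le_mul_of_nonneg_right
      ((mul_le_mul_of_nonneg_right (show ε ≤ ε₀ by linarith) h5).trans h3) (pφ y).le
    have h8 := mul_le_mul_of_nonneg_left h4 ht0.le
    simp only [ContinuousMap.sub_apply, ContinuousMap.smul_apply, smul_eq_mul]
    nlinarith
  · have h1 : 0 ≤ 1 - ε / K ^ 4 := by linarith
    have := mul_le_mul_of_nonneg_left (hc y) h1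
    have := hb y
    linarith

/-- Ratios of iterates of elements of the cone converge exponentially fast to constants. -/
theorem exists_ratio_bound (hQ : IsConeContraction δ D a a' Q) :
    ∃ κ : ℝ, 0 ≤ κ ∧ κ < 1 ∧ ∀ n : ℕ, ∀ φ ∈ logCone δ a, ∀ ψ ∈ logCone δ a, ∀ c : ℝ,
      (∀ x, φ x ≤ c * ψ x) → ∃ t : ℝ, 0 ≤ t ∧ ∀ x, t * (Q ^ n) ψ x ≤ (Q ^ n) φ x ∧
        (Q ^ n) φ x ≤ (t + c * κ ^ n) * (Q ^ n) ψ x := by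
  obtain ⟨κ, h0, h1, H⟩ := hQ.exists_split
  refine ⟨κ, h0, h1, fun n => ?_⟩
  induction n with
  | zero =>
    intro φ hφ ψ _ c hc
    exact ⟨0, le_rfl, fun x => ⟨by simpa using (hφ.1 x).le, by simpa using hc x⟩⟩
  | succ n ih =>
    intro φ hφ ψ hψ c hc
    have hc' : ∀ x, Q φ x ≤ c * Q ψ x := fun x => by
      have := hQ.mono (φ := φ) (ψ := c • ψ) (by simpa using hc) x
      simpa using this
    -- The remainder `Q φ - t • Q ψ` is back in the large cone with `c` improved to `c * κ`, so the
    -- induction hypothesis applies to it.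
    obtain ⟨t, ht, hm, hle⟩ := H _ (hQ.maps φ hφ) _ (hQ.maps ψ hψ) c hc'
    obtain ⟨t', ht', h⟩ := ih _ hm _ (logCone_mono hQ.δ_nonneg hQ.lt.le (hQ.maps ψ hψ)) _ hle
    refine ⟨t + t', by positivity, fun x => ?_⟩
    obtain ⟨hl, hu⟩ := h x
    simp only [map_sub, map_smul, ContinuousMap.sub_apply, ContinuousMap.smul_apply,
      smul_eq_mul] at hl hu
    rw [pow_succ_apply, pow_succ_apply, pow_succ κ]
    constructor <;> linarith

end IsConeContraction
end Cone

/-! ### Positive functionals as measures. -/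

section Riesz

variable {X : Type*} [TopologicalSpace X] [CompactSpace X] [T2Space X] [MeasurableSpace X]
  [BorelSpace X]

/-- The Riesz-Markov-Kakutani theorem on a compact space. -/
theorem exists_measure_of_positive (Λ : C(X, ℝ) →ₗ[ℝ] ℝ)
    (hΛ : ∀ φ : C(X, ℝ), (∀ x, 0 ≤ φ x) → 0 ≤ Λ φ) :
    ∃ μ : Measure X, IsFiniteMeasure μ ∧ ∀ φ : C(X, ℝ), ∫ x, φ x ∂μ = Λ φ := by
  let Λ' : CompactlySupportedContinuousMap X ℝ →ₚ[ℝ] ℝ :=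
    { toFun := fun φ => Λ φ.toContinuousMap
      map_add' := fun φ ψ => Λ.map_add φ.toContinuousMap ψ.toContinuousMap
      map_smul' := fun c φ => Λ.map_smul c φ.toContinuousMap
      monotone' := fun φ ψ h => by
        have := hΛ (ψ.toContinuousMap - φ.toContinuousMap) (fun x => by
          have := h x
          simpa using this)
        rw [map_sub] at this
        simpa using this }
  refine ⟨RealRMK.rieszMeasure Λ', inferInstance, fun φ => ?_⟩
  exact RealRMK.integral_rieszMeasure Λ'
    (⟨φ, HasCompactSupport.of_compactSpace _⟩ : CompactlySupportedContinuousMap X ℝ)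

theorem exists_probabilityMeasure_of_positive (Λ : C(X, ℝ) →ₗ[ℝ] ℝ)
    (hΛ : ∀ φ : C(X, ℝ), (∀ x, 0 ≤ φ x) → 0 ≤ Λ φ) (h1 : Λ 1 = 1) :
    ∃ μ : ProbabilityMeasure X, ∀ φ : C(X, ℝ), ∫ x, φ x ∂(μ : Measure X) = Λ φ := by
  obtain ⟨μ, hμ, h⟩ := exists_measure_of_positive Λ hΛ
  have : IsProbabilityMeasure μ := ⟨by
    have := h 1
    simp only [ContinuousMap.one_apply, integral_const, smul_eq_mul, mul_one, h1] at this
    rw [Measure.real, ENNReal.toReal_eq_one_iff] at this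
    exact this⟩
  exact ⟨⟨μ, this⟩, h⟩

end Riesz

theorem continuousMap_integrable {X : Type*} [TopologicalSpace X] [CompactSpace X]
    [MeasurableSpace X] [BorelSpace X] {E : Type*} [NormedAddCommGroup E]
    [SecondCountableTopologyEither X E] (μ : Measure X)
    [IsFiniteMeasure μ] (φ : C(X, E)) : Integrable (fun x => φ x) μ :=
  φ.continuous.integrable_of_hasCompactSupport (HasCompactSupport.of_compactSpace _)

/-! ### The limit measure and the Perron eigenfunction of a cone contraction. -/

namespace IsConeContraction

variable {X : Type*} [TopologicalSpace X] [CompactSpace X] {δ : X → X → ℝ} {D a a' : ℝ}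
  {Q : C(X, ℝ) →L[ℝ] C(X, ℝ)}

/-- For every continuous `φ`, the ratios `Q^n φ / Q^n 1` become nearly constant. -/
theorem exists_ratio_near_const (hQ : IsConeContraction δ D a a' Q)
    (hd : ∀ φ : C(X, ℝ), ∀ ε > 0, ∃ φ' ∈ logCone δ a, ∃ c : ℝ, ∀ x, |φ x - (φ' x - c)| ≤ ε)
    (φ : C(X, ℝ)) {ε : ℝ} (hε : 0 < ε) :
    ∃ (t : ℝ) (N : ℕ), ∀ n ≥ N, ∀ x, t * (Q ^ n) 1 x ≤ (Q ^ n) φ x ∧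
      (Q ^ n) φ x ≤ (t + ε) * (Q ^ n) 1 x := by
  -- One index suffices: applying the positive operator `Q ^ k` propagates both inequalities.
  suffices h : ∃ (t : ℝ) (N : ℕ), ∀ x, t * (Q ^ N) 1 x ≤ (Q ^ N) φ x ∧
      (Q ^ N) φ x ≤ (t + ε) * (Q ^ N) 1 x by
    obtain ⟨t, N, h⟩ := h
    refine ⟨t, N, fun n hn => ?_⟩
    obtain ⟨k, rfl⟩ := Nat.exists_eq_add_of_le' hn
    intro x
    have e : ∀ ψ, (Q ^ (k + N)) ψ = (Q ^ k) ((Q ^ N) ψ) := fun ψ => by rw [pow_add]; rfl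
    have h1 := hQ.pow_mono k (φ := t • (Q ^ N) 1) (ψ := (Q ^ N) φ) (fun x => (h x).1) x
    have h2 := hQ.pow_mono k (φ := (Q ^ N) φ) (ψ := (t + ε) • (Q ^ N) 1) (fun x => (h x).2) x
    rw [map_smul] at h1 h2
    rw [e, e]
    exact ⟨h1, h2⟩
  obtain ⟨φ', hφ', c, hc⟩ := hd φ (ε / 3) (by positivity)
  obtain ⟨κ, h0, h1, H⟩ := hQ.exists_ratio_bound
  have hκ := (tendsto_pow_atTop_nhds_zero_of_lt_one h0 h1).const_mul ‖φ'‖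
  rw [mul_zero] at hκ
  obtain ⟨N, hN⟩ := (hκ.eventually (gt_mem_nhds (show 0 < ε / 3 by positivity))).exists
  obtain ⟨t, -, ht⟩ := H N φ' hφ' 1 (one_mem_logCone hQ.δ_nonneg (hQ.nonneg.trans hQ.lt.le)) ‖φ'‖
    (fun x => by simpa using (le_abs_self _).trans (φ'.norm_coe_le_norm x))
  -- The approximation of `φ` by `φ' - c` costs `ε / 3` on each side, and the ratio bound for `φ'`
  -- another `ε / 3`.
  refine ⟨t - c - ε / 3, N, fun x => ?_⟩
  have l := hQ.pow_mono N (φ := φ' - (c + ε / 3) • 1) (ψ := φ) (fun y => by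
    have := abs_le.1 (hc y)
    simp; linarith) x
  have u := hQ.pow_mono N (φ := φ) (ψ := φ' + (ε / 3 - c) • 1) (fun y => by
    have := abs_le.1 (hc y)
    simp; linarith) x
  simp only [map_sub, map_add, map_smul, ContinuousMap.sub_apply, ContinuousMap.add_apply,
    ContinuousMap.smul_apply, smul_eq_mul] at l u
  have p := hQ.pow_one_pos N x
  obtain ⟨t1, t2⟩ := ht x
  have := mul_le_mul_of_nonneg_right hN.le p.le
  constructor <;> nlinarith

variable [T2Space X] [MeasurableSpace X] [BorelSpace X] [Nonempty X]

/-- The ratios `Q^n φ / Q^n 1` converge uniformly to the integral of `φ` with respect to a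
probability measure. -/
theorem exists_limit_measure (hQ : IsConeContraction δ D a a' Q)
    (hd : ∀ φ : C(X, ℝ), ∀ ε > 0, ∃ φ' ∈ logCone δ a, ∃ c : ℝ, ∀ x, |φ x - (φ' x - c)| ≤ ε) :
    ∃ ν : ProbabilityMeasure X, ∀ φ : C(X, ℝ), ∀ ε > 0, ∃ N : ℕ, ∀ n ≥ N, ∀ x,
      |(Q ^ n) φ x - (∫ y, φ y ∂(ν : Measure X)) * (Q ^ n) 1 x| ≤ ε * (Q ^ n) 1 x := by
  obtain ⟨x₀⟩ := ‹Nonempty X›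
  let R : ℕ → C(X, ℝ) → ℝ := fun n φ => (Q ^ n) φ x₀ / (Q ^ n) 1 x₀
  have hR : ∀ φ : C(X, ℝ), ∃ l, Tendsto (fun n => R n φ) atTop (𝓝 l) := fun φ => by
    apply cauchySeq_tendsto_of_complete
    rw [Metric.cauchySeq_iff']
    intro ε hε
    obtain ⟨t, N, h⟩ := hQ.exists_ratio_near_const hd φ (half_pos hε)
    have hb : ∀ n ≥ N, t ≤ R n φ ∧ R n φ ≤ t + ε / 2 := fun n hn => by
      have p := hQ.pow_one_pos n x₀
      exact ⟨(le_div_iff₀ p).2 (h n hn x₀).1, (div_le_iff₀ p).2 (h n hn x₀).2⟩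
    refine ⟨N, fun n hn => ?_⟩
    have h1 := hb n hn
    have h2 := hb N le_rfl
    rw [Real.dist_eq, abs_lt]
    constructor <;> linarith [h1.1, h1.2, h2.1, h2.2]
  choose l hl using hR
  let Λ : C(X, ℝ) →ₗ[ℝ] ℝ :=
    { toFun := l
      map_add' := fun φ ψ => tendsto_nhds_unique (hl _) <| by
        refine ((hl φ).add (hl ψ)).congr fun n => ?_
        simp only [R, map_add, ContinuousMap.add_apply, add_div]
      map_smul' := fun c φ => tendsto_nhds_unique (hl _) <| by
        refine ((hl φ).const_mul c).congr fun n => ?_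
        simp only [R, map_smul, ContinuousMap.smul_apply, smul_eq_mul, mul_div_assoc] }
  obtain ⟨ν, hν⟩ := exists_probabilityMeasure_of_positive Λ
    (fun φ hφ => ge_of_tendsto' (hl φ) fun n =>
      div_nonneg (hQ.pow_pos' n hφ x₀) (hQ.pow_one_pos n x₀).le)
    (tendsto_nhds_unique (hl 1) (tendsto_const_nhds.congr fun n =>
      (div_self (hQ.pow_one_pos n x₀).ne').symm))
  refine ⟨ν, fun φ ε hε => ?_⟩
  obtain ⟨t, N, h⟩ := hQ.exists_ratio_near_const hd φ hε
  have h1 : t ≤ l φ := ge_of_tendsto (hl φ) <| eventually_atTop.2 ⟨N, fun n hn =>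
    (le_div_iff₀ (hQ.pow_one_pos n x₀)).2 (h n hn x₀).1⟩
  have h2 : l φ ≤ t + ε := le_of_tendsto (hl φ) <| eventually_atTop.2 ⟨N, fun n hn =>
    (div_le_iff₀ (hQ.pow_one_pos n x₀)).2 (h n hn x₀).2⟩
  refine ⟨N, fun n hn x => ?_⟩
  rw [hν φ, show Λ φ = l φ from rfl, abs_le]
  have p := hQ.pow_one_pos n x
  obtain ⟨h3, h4⟩ := h n hn x
  constructor <;> nlinarith

/-- The Ruelle-Perron-Frobenius theorem for cone contractions. -/
theorem exists_eigendata (hQ : IsConeContraction δ D a a' Q)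
    (hd : ∀ φ : C(X, ℝ), ∀ ε > 0, ∃ φ' ∈ logCone δ a, ∃ c : ℝ, ∀ x, |φ x - (φ' x - c)| ≤ ε) :
    ∃ (lam : ℝ) (ν : ProbabilityMeasure X) (h : C(X, ℝ)), 0 < lam ∧
      (∀ φ : C(X, ℝ), ∫ x, Q φ x ∂(ν : Measure X) = lam * ∫ x, φ x ∂(ν : Measure X)) ∧
      Q h = lam • h ∧ ∫ x, h x ∂(ν : Measure X) = 1 ∧
      Tendsto (fun n => (lam ^ n)⁻¹ • (Q ^ n) 1) atTop (𝓝 h) := by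
  obtain ⟨ν, hν⟩ := hQ.exists_limit_measure hd
  obtain ⟨x₀⟩ := ‹Nonempty X›
  let I : C(X, ℝ) → ℝ := fun φ => ∫ x, φ x ∂(ν : Measure X)
  have hint : ∀ φ : C(X, ℝ), Integrable (fun x => φ x) (ν : Measure X) :=
    fun φ => continuousMap_integrable _ φ
  have Imono : ∀ φ ψ : C(X, ℝ), (∀ x, φ x ≤ ψ x) → I φ ≤ I ψ := fun φ ψ h =>
    integral_mono (hint φ) (hint ψ) h
  have Ismul : ∀ (c : ℝ) (φ : C(X, ℝ)), I (c • φ) = c * I φ := fun c φ => integral_const_mul _ _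
  have Ione : I 1 = 1 := by simp [I]
  have hlim : ∀ φ : C(X, ℝ),
      Tendsto (fun n => (Q ^ n) φ x₀ / (Q ^ n) 1 x₀) atTop (𝓝 (I φ)) := fun φ => by
    rw [Metric.tendsto_atTop]
    intro ε hε
    obtain ⟨N, hN⟩ := hν φ (ε / 2) (half_pos hε)
    refine ⟨N, fun n hn => ?_⟩
    have p := hQ.pow_one_pos n x₀
    have : (Q ^ n) φ x₀ / (Q ^ n) 1 x₀ - I φ = ((Q ^ n) φ x₀ - I φ * (Q ^ n) 1 x₀) / (Q ^ n) 1 x₀ := by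
      field_simp
    rw [Real.dist_eq, this, abs_div, abs_of_pos p]
    exact ((div_le_iff₀ p).2 (hN n hn x₀)).trans_lt (by linarith)
  set lam := I (Q 1) with hlam
  have ha : 0 ≤ a := hQ.nonneg.trans hQ.lt.le
  have h1 : (1 : C(X, ℝ)) ∈ logCone δ a := one_mem_logCone hQ.δ_nonneg ha
  have hQI : ∀ φ, I (Q φ) = lam * I φ := fun φ => by
    refine tendsto_nhds_unique (hlim (Q φ)) ?_
    -- This is $\frac{Q^n(Q\varphi)}{Q^n1}=\frac{Q^n(Q1)}{Q^n1}\cdot\frac{Q^{n+1}\varphi}{Q^{n+1}1}$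
    -- at `x₀`.
    refine ((hlim (Q 1)).mul ((hlim φ).comp (tendsto_add_atTop_nat 1))).congr fun n => ?_
    have p := (hQ.pow_one_pos n x₀).ne'
    have p' := (hQ.pow_one_pos (n + 1) x₀).ne'
    simp only [Function.comp_apply]
    rw [← pow_succ_apply, ← pow_succ_apply]
    field_simp
  have hlam0 : 0 < lam := by
    have hm := hQ.maps 1 h1
    have h2 : ∀ x, Real.exp (-(a' * D)) * Q 1 x₀ ≤ Q 1 x := fun x => by
      rw [Real.exp_neg, inv_mul_le_iff₀ (Real.exp_pos _)]
      exact hQ.apply_le hQ.nonneg hm x₀ x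
    have h3 := Imono ((Real.exp (-(a' * D)) * Q 1 x₀) • 1) (Q 1) (fun x => by simpa using h2 x)
    rw [Ismul, Ione, mul_one] at h3
    exact lt_of_lt_of_le (mul_pos (Real.exp_pos _) (hm.1 x₀)) h3
  have hQnI : ∀ n φ, I ((Q ^ n) φ) = lam ^ n * I φ := fun n φ => by
    induction n with
    | zero => simp
    | succ n ih => rw [pow_succ_apply', hQI, ih, pow_succ]; ring
  let v : ℕ → C(X, ℝ) := fun n => (lam ^ n)⁻¹ • (Q ^ n) 1
  have vmem : ∀ n, v n ∈ logCone δ a := fun n => smul_mem_logCone (by positivity) (hQ.pow_mem n h1)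
  have Iv : ∀ n, I (v n) = 1 := fun n => by
    rw [Ismul, hQnI, Ione, mul_one, inv_mul_cancel₀ (by positivity)]
  set K := Real.exp (a * D) with hK
  have hK0 : 0 < K := Real.exp_pos _
  have vle : ∀ n x, v n x ≤ K := fun n x => by
    have := Imono (v n x • 1) (K • v n) (fun y => by
      simpa using hQ.apply_le ha (vmem n) x y)
    rw [Ismul, Ismul, Iv, Ione] at this
    linarith
  obtain ⟨κ, hκ0, hκ1, H⟩ := hQ.exists_ratio_bound
  -- Here `v (n + j)` is the normalized $n$-th iterate of `v j`, to be compared with that of `1`.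
  -- Both have integral one, which forces `t ≤ 1 ≤ t + K * κ ^ n`, so the ratio `v (n + j) / v n` is
  -- within `K * κ ^ n` of one.
  have vd : ∀ n j x, |v (n + j) x - v n x| ≤ K * κ ^ n * K := fun n j x => by
    obtain ⟨t, -, ht⟩ := H n (v j) (vmem j) 1 h1 K (fun x => by simpa using vle j x)
    have e1 := Imono (t • (Q ^ n) 1) ((Q ^ n) (v j)) (fun x => (ht x).1)
    have e2 := Imono ((Q ^ n) (v j)) ((t + K * κ ^ n) • (Q ^ n) 1) (fun x => (ht x).2)
    have pn : 0 < lam ^ n := by positivity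
    rw [Ismul, hQnI, hQnI, Ione, Iv] at e1 e2
    have t1 : t ≤ 1 := by nlinarith
    have t2 : 1 ≤ t + K * κ ^ n := by nlinarith
    have e3 : v (n + j) = (lam ^ n)⁻¹ • (Q ^ n) (v j) := by
      simp only [v, map_smul]
      rw [pow_add, pow_add, smul_smul, mul_inv]
      rfl
    have e4 : (Q ^ n) 1 x = lam ^ n * v n x := by
      simp only [v, ContinuousMap.smul_apply, smul_eq_mul]
      field_simp
    have e5 : (Q ^ n) (v j) x = lam ^ n * v (n + j) x := by
      rw [e3]
      simp only [ContinuousMap.smul_apply, smul_eq_mul]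
      field_simp
    obtain ⟨h3, h4⟩ := ht x
    rw [e4, e5] at h3 h4
    have h5 : t * v n x ≤ v (n + j) x := by nlinarith
    have h6 : v (n + j) x ≤ (t + K * κ ^ n) * v n x := by nlinarith
    have h7 := vle n x
    have h8 := (vmem n).1 x
    have h9 : 0 ≤ K * κ ^ n := by positivity
    rw [abs_le]
    constructor <;> nlinarith
  have hcau : CauchySeq v := by
    rw [Metric.cauchySeq_iff']
    intro ε hε
    have hκ := ((tendsto_pow_atTop_nhds_zero_of_lt_one hκ0 hκ1).const_mul K).mul_const K
    rw [mul_zero, zero_mul] at hκ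
    obtain ⟨N, hN⟩ := (hκ.eventually (gt_mem_nhds hε)).exists
    refine ⟨N, fun n hn => ?_⟩
    obtain ⟨j, rfl⟩ := Nat.exists_eq_add_of_le hn
    rw [dist_eq_norm]
    refine lt_of_le_of_lt ((ContinuousMap.norm_le _ (by positivity)).2 fun x => ?_) hN
    exact vd N j x
  obtain ⟨h, hh⟩ := cauchySeq_tendsto_of_complete hcau
  refine ⟨lam, ν, h, hlam0, hQI, ?_, ?_, hh⟩
  · refine tendsto_nhds_unique ((Q.continuous.tendsto h).comp hh) ?_
    refine ((hh.comp (tendsto_add_atTop_nat 1)).const_smul lam).congr fun n => ?_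
    simp only [Function.comp_apply, v, map_smul]
    rw [pow_succ_apply', smul_smul, pow_succ, mul_inv]
    congr 1
    field_simp
  · have hc : Continuous I := by
      refine (LipschitzWith.of_dist_le_mul (K := 1) fun φ ψ => ?_).continuous
      rw [Real.dist_eq, ← integral_sub (hint φ) (hint ψ), dist_eq_norm, NNReal.coe_one, one_mul]
      refine (norm_integral_le_of_norm_le_const (C := ‖φ - ψ‖) (.of_forall fun x =>
        (φ - ψ).norm_coe_le_norm x)).trans (by simp)
    exact tendsto_nhds_unique ((hc.tendsto h).comp hh)
      (tendsto_const_nhds.congr fun n => (Iv n).symm)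

end IsConeContraction

/-! ### The metric on the lattice space and Hölder functions. -/

namespace CoupledLattice

variable (S : CoupledLattice)

theorem dI_self (x : unitInterval) : S.dI x x = 0 := (S.dI_eq_zero x x).2 rfl

theorem dI_nonneg (x y : unitInterval) : 0 ≤ S.dI x y := by
  have h := S.dI_triangle x y x
  rw [S.dI_self, S.dI_symm y x] at h
  linarith

theorem continuous_dI_right (c : unitInterval) : Continuous (S.dI c) := by
  rw [continuous_iff_continuousAt]
  intro x
  rw [ContinuousAt, Metric.tendsto_nhds]
  intro ε hε
  filter_upwards [(S.dI_basis x).mem_of_mem hε] with y hy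
  have h1 := S.dI_triangle c x y
  have h2 := S.dI_triangle c y x
  rw [S.dI_symm y x] at h2
  have hy : S.dI x y < ε := hy
  rw [Real.dist_eq, abs_lt]
  constructor <;> linarith

theorem exists_dI_le : ∃ M : ℝ, ∀ x y, S.dI x y ≤ M := by
  obtain ⟨x₀, -, h⟩ := isCompact_univ.exists_isMaxOn univ_nonempty
    (S.continuous_dI_right 0).continuousOn
  refine ⟨2 * S.dI 0 x₀, fun x y => ?_⟩
  have h1 : S.dI 0 x ≤ S.dI 0 x₀ := h (mem_univ x)
  have h2 : S.dI 0 y ≤ S.dI 0 x₀ := h (mem_univ y)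
  have h3 := S.dI_triangle x 0 y
  rw [S.dI_symm x 0] at h3
  linarith

/-- An upper bound for the metric on the unit interval. -/
noncomputable def diamBound : ℝ := S.exists_dI_le.choose

theorem dI_le (x y : unitInterval) : S.dI x y ≤ S.diamBound := S.exists_dI_le.choose_spec x y

theorem θ_pow_pos (k : ℤ) : 0 < S.θ ^ k.natAbs := pow_pos S.θ_mem.1 _

theorem weight_nonneg (x y : LatticeSpace) (k : ℤ) : 0 ≤ S.θ ^ k.natAbs * S.dI (x k) (y k) :=
  mul_nonneg (S.θ_pow_pos k).le (S.dI_nonneg _ _)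

theorem bddAbove_weight (x y : LatticeSpace) :
    BddAbove (range fun k : ℤ => S.θ ^ k.natAbs * S.dI (x k) (y k)) := by
  refine ⟨S.diamBound, ?_⟩
  rintro _ ⟨k, rfl⟩
  calc S.θ ^ k.natAbs * S.dI (x k) (y k) ≤ 1 * S.dI (x k) (y k) := by
        gcongr
        · exact S.dI_nonneg _ _
        · exact pow_le_one₀ S.θ_mem.1.le S.θ_mem.2.le
    _ ≤ _ := by rw [one_mul]; exact S.dI_le _ _

theorem weight_le_d (x y : LatticeSpace) (k : ℤ) : S.θ ^ k.natAbs * S.dI (x k) (y k) ≤ S.d x y :=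
  le_ciSup (S.bddAbove_weight x y) k

theorem d_le {x y : LatticeSpace} {c : ℝ} (h : ∀ k : ℤ, S.θ ^ k.natAbs * S.dI (x k) (y k) ≤ c) :
    S.d x y ≤ c := ciSup_le h

theorem d_nonneg (x y : LatticeSpace) : 0 ≤ S.d x y :=
  (S.weight_nonneg x y 0).trans (S.weight_le_d x y 0)

theorem d_symm (x y : LatticeSpace) : S.d x y = S.d y x := by
  simp only [d, latticeDist, S.dI_symm]

theorem d_le_diamBound (x y : LatticeSpace) : S.d x y ≤ S.diamBound := S.d_le fun k => by
  calc _ ≤ 1 * S.dI (x k) (y k) := by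
        gcongr
        · exact S.dI_nonneg _ _
        · exact pow_le_one₀ S.θ_mem.1.le S.θ_mem.2.le
    _ ≤ _ := by rw [one_mul]; exact S.dI_le _ _

theorem eq_of_d_eq_zero {x y : LatticeSpace} (h : S.d x y = 0) : x = y := by
  funext k
  have h1 := S.weight_le_d x y k
  have h2 := S.dI_nonneg (x k) (y k)
  have h3 := S.θ_pow_pos k
  rw [← S.dI_eq_zero]
  rw [h] at h1
  nlinarith

theorem β_pos : 0 < S.β := S.β_mem.1

/-- The power `d^β` of the metric on the lattice space. -/
noncomputable def dβ (x y : LatticeSpace) : ℝ := S.d x y ^ S.β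

theorem dβ_nonneg (x y : LatticeSpace) : 0 ≤ S.dβ x y := Real.rpow_nonneg (S.d_nonneg x y) _

theorem dβ_symm (x y : LatticeSpace) : S.dβ x y = S.dβ y x := by rw [dβ, d_symm, dβ]

theorem dβ_le (x y : LatticeSpace) : S.dβ x y ≤ S.diamBound ^ S.β :=
  Real.rpow_le_rpow (S.d_nonneg x y) (S.d_le_diamBound x y) S.β_pos.le

theorem dβ_le_of_d_le {x y x' y' : LatticeSpace} {c : ℝ} (hc : 0 ≤ c)
    (h : S.d x' y' ≤ c * S.d x y) : S.dβ x' y' ≤ c ^ S.β * S.dβ x y := by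
  rw [dβ, dβ, ← Real.mul_rpow hc (S.d_nonneg x y)]
  exact Real.rpow_le_rpow (S.d_nonneg _ _) h S.β_pos.le

/-- On a bounded space Lipschitz functions are $\beta$-Hölder; this is needed for the coordinate
functions in Stone-Weierstrass. -/
theorem d_le_dβ (x y : LatticeSpace) : S.d x y ≤ S.diamBound ^ (1 - S.β) * S.dβ x y := by
  rcases (S.d_nonneg x y).eq_or_lt with h | h
  · rw [← h]
    exact mul_nonneg (Real.rpow_nonneg ((S.d_nonneg x y).trans (S.d_le_diamBound x y)) _)
      (S.dβ_nonneg x y)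
  · calc S.d x y = S.d x y ^ (1 - S.β) * S.d x y ^ S.β := by
          rw [← Real.rpow_add h]; simp
      _ ≤ _ := by
          refine mul_le_mul_of_nonneg_right ?_ (S.dβ_nonneg x y)
          exact Real.rpow_le_rpow h.le (S.d_le_diamBound x y) (by linarith [S.β_mem.2])

theorem d_proj_le (k : ℕ) (x y : LatticeSpace) : S.d (S.proj k x) (S.proj k y) ≤ S.d x y := by
  refine S.d_le fun j => ?_
  by_cases hj : j ∈ Finset.Icc (-(k : ℤ)) k
  · simp only [proj, if_pos hj]
    exact S.weight_le_d x y j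
  · simp only [proj, if_neg hj, S.dI_self, mul_zero]
    exact S.d_nonneg x y

theorem eventually_mem_Icc (j : ℤ) : ∀ᶠ k : ℕ in atTop, j ∈ Finset.Icc (-(k : ℤ)) k := by
  filter_upwards [eventually_ge_atTop j.natAbs] with k hk
  rw [Finset.mem_Icc]
  omega

theorem tendsto_proj (x : LatticeSpace) : Tendsto (fun k => S.proj k x) atTop (𝓝 x) := by
  rw [tendsto_pi_nhds]
  intro j
  refine tendsto_const_nhds.congr' ?_
  filter_upwards [eventually_mem_Icc j] with k hk
  simp only [proj, if_pos hk]

section Holder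

variable {F : Type*} [NormedAddCommGroup F] {Φ : LatticeSpace → F}

theorem holderConst_nonneg : 0 ≤ S.holderConst Φ :=
  Real.iSup_nonneg fun _ => div_nonneg (norm_nonneg _) (Real.rpow_nonneg (S.d_nonneg _ _) _)

/-- Passing to the limit $\pi_kx\to x$ turns the bound uniform in $k$ into an ordinary Hölder bound.
With the converse `inC_of_norm_sub_le`, where $\pi_k$ does not increase $d$, this identifies
$\mathcal C$ with the $\beta$-Hölder continuous functions. -/
theorem InC.norm_sub_le {S : CoupledLattice} (h : S.InC Φ) (x y : LatticeSpace) :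
    ‖Φ x - Φ y‖ ≤ S.holderConst Φ * S.dβ x y := by
  have hk : ∀ k, ‖Φ (S.proj k x) - Φ (S.proj k y)‖ ≤ S.holderConst Φ * S.dβ x y := fun k => by
    rcases eq_or_ne x y with rfl | hne
    · simpa using mul_nonneg S.holderConst_nonneg (S.dβ_nonneg x x)
    · have hd : 0 < S.dβ x y := Real.rpow_pos_of_pos
        ((S.d_nonneg x y).lt_of_ne fun h0 => hne (S.eq_of_d_eq_zero h0.symm)) _
      rw [← div_le_iff₀ hd]
      exact le_ciSup h.2 (k, x, y)
  exact le_of_tendsto' (((h.1.tendsto x).comp (S.tendsto_proj x)).sub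
    ((h.1.tendsto y).comp (S.tendsto_proj y))).norm hk

theorem inC_of_norm_sub_le (hΦ : Continuous Φ) {C : ℝ} (hC : 0 ≤ C)
    (h : ∀ x y, ‖Φ x - Φ y‖ ≤ C * S.dβ x y) : S.InC Φ := by
  refine ⟨hΦ, C, ?_⟩
  rintro _ ⟨⟨k, x, y⟩, rfl⟩
  refine div_le_of_le_mul₀ (S.dβ_nonneg x y) hC ((h _ _).trans ?_)
  exact mul_le_mul_of_nonneg_left
    (Real.rpow_le_rpow (S.d_nonneg _ _) (S.d_proj_le k x y) S.β_pos.le) hC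

end Holder

/-- The weights $\theta^{|k|}$ make all but finitely many coordinates negligible, so product
neighbourhoods are small for $d$. -/
theorem eventually_d_lt (x : LatticeSpace) {ε : ℝ} (hε : 0 < ε) :
    ∀ᶠ y in 𝓝 x, S.d x y < ε := by
  have hM := (tendsto_pow_atTop_nhds_zero_of_lt_one S.θ_mem.1.le S.θ_mem.2).mul_const S.diamBound
  rw [zero_mul] at hM
  obtain ⟨N, hN⟩ := (hM.eventually (gt_mem_nhds (half_pos hε))).exists
  have hfin : ∀ᶠ y in 𝓝 x, ∀ k ∈ Finset.Icc (-(N : ℤ)) N, S.dI (x k) (y k) < ε / 2 := by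
    rw [Filter.eventually_all_finset]
    intro k _
    exact (continuous_apply k).continuousAt.eventually
      ((S.dI_basis (x k)).mem_of_mem (half_pos hε))
  filter_upwards [hfin] with y hy
  refine lt_of_le_of_lt (S.d_le fun k => ?_) (half_lt_self hε)
  by_cases hk : k ∈ Finset.Icc (-(N : ℤ)) N
  · calc _ ≤ 1 * S.dI (x k) (y k) := by
          gcongr
          · exact S.dI_nonneg _ _
          · exact pow_le_one₀ S.θ_mem.1.le S.θ_mem.2.le
      _ ≤ _ := by rw [one_mul]; exact (hy k hk).le
  · have hkN : N ≤ k.natAbs := by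
      rw [Finset.mem_Icc] at hk
      omega
    calc S.θ ^ k.natAbs * S.dI (x k) (y k) ≤ S.θ ^ N * S.diamBound := by
          refine mul_le_mul ?_ (S.dI_le _ _) (S.dI_nonneg _ _) (pow_pos S.θ_mem.1 _).le
          exact pow_le_pow_of_le_one S.θ_mem.1.le S.θ_mem.2.le hkN
      _ ≤ _ := hN.le

/-- The metric controls each coordinate up to the factor $\theta^{-|k|}$; with `eventually_d_lt`,
Lipschitz maps for $d$ are continuous for the product topology. -/
theorem continuous_of_d_le {G : LatticeSpace → LatticeSpace} {c : ℝ} (hc : 0 < c)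
    (h : ∀ x y, S.d (G x) (G y) ≤ c * S.d x y) : Continuous G := by
  refine continuous_pi fun k => continuous_iff_continuousAt.2 fun x => ?_
  rw [ContinuousAt, (S.dI_basis (G x k)).tendsto_right_iff]
  intro ε hε
  have hε' : 0 < S.θ ^ k.natAbs * ε / c := div_pos (mul_pos (S.θ_pow_pos k) hε) hc
  filter_upwards [S.eventually_d_lt x hε'] with y hy
  have h1 := (S.weight_le_d (G x) (G y) k).trans (h x y)
  rw [lt_div_iff₀ hc] at hy
  have h2 : S.θ ^ k.natAbs * S.dI (G x k) (G y k) < S.θ ^ k.natAbs * ε := by linarith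
  exact lt_of_mul_lt_mul_left h2 (S.θ_pow_pos k).le

theorem d_E_symm_le (x y : LatticeSpace) : S.d (S.E.symm x) (S.E.symm y) ≤ S.CE * S.d x y := by
  have h := S.E_inv_lipschitz 0 x y
  have e : ∀ z : LatticeSpace, latticeShift 0 z = z := fun z => by
    funext i; simp [latticeShift]
  rw [e, e, e, e] at h
  exact h

theorem continuous_E_symm : Continuous S.E.symm :=
  S.continuous_of_d_le S.CE_mem.1 S.d_E_symm_le

theorem d_branchPoint_le (k : ℕ) (s : Finset.Icc (-(k : ℤ)) k → Fin S.b) (x y : LatticeSpace) :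
    S.d (S.branchPoint k s x) (S.branchPoint k s y) ≤ S.η * S.d x y := by
  refine S.d_le fun j => ?_
  by_cases hj : j ∈ Finset.Icc (-(k : ℤ)) k
  · simp only [branchPoint, dif_pos hj]
    calc _ ≤ S.θ ^ j.natAbs * (S.η * S.dI (x j) (y j)) :=
          mul_le_mul_of_nonneg_left (S.ζ_contract _ _ _) (S.θ_pow_pos j).le
      _ = S.η * (S.θ ^ j.natAbs * S.dI (x j) (y j)) := by ring
      _ ≤ _ := mul_le_mul_of_nonneg_left (S.weight_le_d x y j) S.η_mem.1.le
  · simp only [branchPoint, dif_neg hj, S.dI_self, mul_zero]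
    exact mul_nonneg S.η_mem.1.le (S.d_nonneg x y)

theorem continuous_branchPoint (k : ℕ) (s : Finset.Icc (-(k : ℤ)) k → Fin S.b) :
    Continuous (S.branchPoint k s) :=
  S.continuous_of_d_le S.η_mem.1 (S.d_branchPoint_le k s)

theorem b_pos : 0 < S.b := by
  rcases Nat.eq_zero_or_pos S.b with h | h
  · have h0 : (0 : Fin (S.b + 1)) = Fin.last S.b := by
      ext
      simp [h]
    have h1 := S.a_zero
    rw [h0, S.a_last] at h1
    exact absurd h1 one_ne_zero
  · exact h

/-! ### Density of Hölder functions and of the cones. -/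

/-- The subalgebra of Hölder continuous functions. -/
noncomputable def holderSubalgebra : Subalgebra ℝ C(LatticeSpace, ℝ) where
  carrier := {φ | ∃ C, 0 ≤ C ∧ ∀ x y, ‖φ x - φ y‖ ≤ C * S.dβ x y}
  mul_mem' := by
    rintro φ ψ ⟨C, hC, h⟩ ⟨C', hC', h'⟩
    refine ⟨‖φ‖ * C' + C * ‖ψ‖, by positivity, fun x y => ?_⟩
    have e : (φ * ψ) x - (φ * ψ) y = φ x * (ψ x - ψ y) + (φ x - φ y) * ψ y := by
      simp only [ContinuousMap.mul_apply]; ring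
    rw [e]
    calc _ ≤ ‖φ x‖ * ‖ψ x - ψ y‖ + ‖φ x - φ y‖ * ‖ψ y‖ := by
          rw [← norm_mul, ← norm_mul]; exact norm_add_le _ _
      _ ≤ ‖φ‖ * (C' * S.dβ x y) + C * S.dβ x y * ‖ψ‖ := by
          have := S.dβ_nonneg x y
          gcongr
          · exact φ.norm_coe_le_norm x
          · exact h' x y
          · exact h x y
          · exact ψ.norm_coe_le_norm y
      _ = _ := by ring
  add_mem' := by
    rintro φ ψ ⟨C, hC, h⟩ ⟨C', hC', h'⟩
    refine ⟨C + C', by positivity, fun x y => ?_⟩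
    have e : (φ + ψ) x - (φ + ψ) y = (φ x - φ y) + (ψ x - ψ y) := by
      simp only [ContinuousMap.add_apply]; ring
    rw [e, add_mul]
    exact (norm_add_le _ _).trans (add_le_add (h x y) (h' x y))
  algebraMap_mem' r := ⟨0, le_rfl, fun x y => by simp⟩

/-- A coordinate $k$ where $x$ and $y$ differ gives the separating function $z\mapsto d_I(x_k,z_k)$.
-/
theorem holderSubalgebra_separatesPoints : S.holderSubalgebra.SeparatesPoints := by
  intro x y hxy
  obtain ⟨k, hk⟩ := Function.ne_iff.1 hxy
  refine ⟨fun z => S.dI (x k) (z k), ⟨⟨fun z => S.dI (x k) (z k),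
    (S.continuous_dI_right _).comp (continuous_apply k)⟩,
    ⟨(S.θ ^ k.natAbs)⁻¹ * S.diamBound ^ (1 - S.β), ?_, fun z w => ?_⟩, rfl⟩, ?_⟩
  · have := S.θ_pow_pos k
    have := (S.d_nonneg x y).trans (S.d_le_diamBound x y)
    positivity
  · have h1 := S.dI_triangle (x k) (z k) (w k)
    have h2 := S.dI_triangle (x k) (w k) (z k)
    rw [S.dI_symm (w k) (z k)] at h2
    have h3 : S.dI (z k) (w k) ≤ (S.θ ^ k.natAbs)⁻¹ * S.d z w := by
      rw [le_inv_mul_iff₀ (S.θ_pow_pos k)]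
      exact S.weight_le_d z w k
    have h4 := mul_le_mul_of_nonneg_left (S.d_le_dβ z w) (inv_pos.2 (S.θ_pow_pos k)).le
    rw [mul_assoc, Real.norm_eq_abs, abs_le]
    simp only [ContinuousMap.coe_mk]
    constructor <;> linarith
  · simp only [S.dI_self]
    exact fun h => hk ((S.dI_eq_zero _ _).1 h.symm)

theorem exists_holder_near (φ : C(LatticeSpace, ℝ)) {ε : ℝ} (hε : 0 < ε) :
    ∃ ψ : C(LatticeSpace, ℝ), (∃ C, 0 ≤ C ∧ ∀ x y, ‖ψ x - ψ y‖ ≤ C * S.dβ x y) ∧ ‖φ - ψ‖ < ε := by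
  obtain ⟨g, hg⟩ := ContinuousMap.exists_mem_subalgebra_near_continuousMap_of_separatesPoints
    S.holderSubalgebra S.holderSubalgebra_separatesPoints φ ε hε
  exact ⟨g, g.2, by rwa [norm_sub_rev]⟩

/-- A Hölder continuous function plus a large constant lies in the cone. -/
theorem exists_add_const_mem_logCone {a : ℝ} (ha : 0 < a) (ψ : C(LatticeSpace, ℝ)) {C : ℝ}
    (hC : 0 ≤ C) (h : ∀ x y, ‖ψ x - ψ y‖ ≤ C * S.dβ x y) :
    ∃ c : ℝ, ψ + c • 1 ∈ logCone S.dβ a := by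
  -- The shifted function is at least `C / a`, so `C * dβ` is absorbed by `a * dβ` times its value,
  -- and `1 + s ≤ exp s` concludes.
  refine ⟨‖ψ‖ + C / a + 1, fun x => ?_, fun x y => ?_⟩
  · have := (abs_le.1 (ψ.norm_coe_le_norm x)).1
    have : 0 ≤ C / a := by positivity
    simp; linarith
  · have h1 := (abs_le.1 (ψ.norm_coe_le_norm y)).1
    have h2 := (abs_le.1 (h x y)).2
    have h3 := Real.add_one_le_exp (a * S.dβ x y)
    have h4 := S.dβ_nonneg x y
    have h5 : C / a ≤ ψ y + (‖ψ‖ + C / a + 1) := by linarith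
    have h6 : 0 ≤ C / a := by positivity
    have h7 : C * S.dβ x y ≤ a * S.dβ x y * (ψ y + (‖ψ‖ + C / a + 1)) := by
      calc C * S.dβ x y = a * S.dβ x y * (C / a) := by field_simp
        _ ≤ _ := by gcongr
    have h8 := mul_le_mul_of_nonneg_right h3 (h6.trans h5)
    simp only [ContinuousMap.add_apply, ContinuousMap.smul_apply, ContinuousMap.one_apply,
      smul_eq_mul, mul_one]
    linarith

/-- This is the density hypothesis `hd` of the abstract cone theorems. -/
theorem logCone_dense {a : ℝ} (ha : 0 < a) (φ : C(LatticeSpace, ℝ)) (ε : ℝ) (hε : ε > 0) :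
    ∃ φ' ∈ logCone S.dβ a, ∃ c : ℝ, ∀ x, |φ x - (φ' x - c)| ≤ ε := by
  obtain ⟨ψ, ⟨C, hC, h⟩, hψ⟩ := S.exists_holder_near φ hε
  obtain ⟨c, hc⟩ := S.exists_add_const_mem_logCone ha ψ hC h
  refine ⟨_, hc, c, fun x => ?_⟩
  have := (φ - ψ).norm_coe_le_norm x
  simpa using this.trans hψ.le

/-- Elements of the cone are Hölder continuous. -/
theorem norm_sub_le_of_mem_logCone {a : ℝ} (ha : 0 ≤ a) {φ : C(LatticeSpace, ℝ)}
    (hφ : φ ∈ logCone S.dβ a) :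
    ∃ C, 0 ≤ C ∧ ∀ x y, ‖φ x - φ y‖ ≤ C * S.dβ x y := by
  have key : ∀ x y, φ x - φ y ≤ a * Real.exp (a * S.diamBound ^ S.β) * ‖φ‖ * S.dβ x y :=
    fun x y => by
    have h1 := hφ.2 x y
    have h2 := Real.add_one_le_exp (-(a * S.dβ x y))
    have h3 : Real.exp (a * S.dβ x y) * Real.exp (-(a * S.dβ x y)) = 1 := by
      rw [← Real.exp_add]; simp
    have h4 := S.dβ_nonneg x y
    have h5 : Real.exp (a * S.dβ x y) ≤ Real.exp (a * S.diamBound ^ S.β) :=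
      Real.exp_le_exp.2 (mul_le_mul_of_nonneg_left (S.dβ_le x y) ha)
    have h6 := Real.exp_pos (a * S.dβ x y)
    have h7 : Real.exp (a * S.dβ x y) - 1 ≤ a * S.dβ x y * Real.exp (a * S.diamBound ^ S.β) := by
      have h8 : 0 ≤ a * S.dβ x y := by positivity
      nlinarith
    have h9 := (le_abs_self _).trans (φ.norm_coe_le_norm y)
    have h10 := hφ.1 y
    calc φ x - φ y ≤ (Real.exp (a * S.dβ x y) - 1) * φ y := by linarith
      _ ≤ a * S.dβ x y * Real.exp (a * S.diamBound ^ S.β) * ‖φ‖ := by gcongr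
      _ = _ := by ring
  refine ⟨_, by positivity, fun x y => abs_le.2 ⟨?_, key x y⟩⟩
  have := key y x
  rw [S.dβ_symm] at this
  linarith

end CoupledLattice

/-! ### Averages over inverse branches and their infinite-volume limit. -/

/-- Restriction along `e` has fibres of constant size, the number of functions on the complement of
the range. -/
theorem sum_comp_injective {A B β : Type*} [Fintype A] [Fintype B] [Fintype β] [DecidableEq A]
    [DecidableEq B] {e : A → B} (he : Function.Injective e) :
    ∃ c : ℝ, ∀ F : (A → β) → ℝ, ∑ s : B → β, F (s ∘ e) = c * ∑ s : A → β, F s := by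
  classical
  let E : (B → β) ≃ (A → β) × ({i // i ∉ range e} → β) :=
    (Equiv.piEquivPiSubtypeProd (· ∈ range e) (fun _ => β)).trans
      (((Equiv.ofInjective e he).arrowCongr (Equiv.refl β)).symm.prodCongr (Equiv.refl _))
  refine ⟨Fintype.card ({i // i ∉ range e} → β), fun F => ?_⟩
  rw [Fintype.sum_equiv E (fun s => F (s ∘ e)) (fun q => F q.1) (fun s => rfl),
    Fintype.sum_prod_type]
  simp only [Finset.sum_const, Finset.card_univ, nsmul_eq_mul]
  rw [Finset.mul_sum]

/-- Averages over `A → β` may be computed as averages over `B → β` when `A` embeds into `B`. -/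
theorem average_comp_injective {A B β : Type*} [Fintype A] [Fintype B] [Fintype β] [DecidableEq A]
    [DecidableEq B] [Nonempty β] {e : A → B} (he : Function.Injective e) (F : (A → β) → ℝ) :
    (Fintype.card (A → β) : ℝ)⁻¹ * ∑ s : A → β, F s =
      (Fintype.card (B → β) : ℝ)⁻¹ * ∑ s : B → β, F (s ∘ e) := by
  obtain ⟨c, hc⟩ := sum_comp_injective (β := β) he
  have h1 := hc fun _ => 1
  simp only [Finset.sum_const, Finset.card_univ, nsmul_eq_mul, mul_one] at h1
  have hB : (Fintype.card (B → β) : ℝ) ≠ 0 := Nat.cast_ne_zero.2 Fintype.card_ne_zero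
  have hA : (Fintype.card (A → β) : ℝ) ≠ 0 := Nat.cast_ne_zero.2 Fintype.card_ne_zero
  have hc0 : c ≠ 0 := fun h => hB (by rw [h1, h, zero_mul])
  rw [hc, h1]
  field_simp

namespace CoupledLattice

variable (S : CoupledLattice)

theorem card_branches (k : ℕ) :
    Fintype.card (Finset.Icc (-(k : ℤ)) k → Fin S.b) = S.b ^ (2 * k + 1) := by
  rw [Fintype.card_fun, Fintype.card_fin, Fintype.card_coe, Int.card_Icc]
  congr 1
  omega

/-- The average over the inverse branches on the finite sublattice `{-k, …, k}`. -/
noncomputable def branchAverage (k : ℕ) : C(LatticeSpace, ℝ) →ₗ[ℝ] C(LatticeSpace, ℝ) where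
  toFun G := ⟨fun x => ((S.b : ℝ) ^ (2 * k + 1))⁻¹ *
    ∑ s : Finset.Icc (-(k : ℤ)) k → Fin S.b, G (S.branchPoint k s x),
    continuous_const.mul (continuous_finsetSum _ fun s _ =>
      G.continuous.comp (S.continuous_branchPoint k s))⟩
  map_add' G H := by
    ext x
    simp only [ContinuousMap.coe_mk, ContinuousMap.add_apply, Finset.sum_add_distrib, mul_add]
  map_smul' c G := by
    ext x
    simp only [ContinuousMap.coe_mk, ContinuousMap.smul_apply, smul_eq_mul, ← Finset.mul_sum,
      RingHom.id_apply]
    ring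

theorem branchAverage_apply (k : ℕ) (G : C(LatticeSpace, ℝ)) (x : LatticeSpace) :
    S.branchAverage k G x = ((S.b : ℝ) ^ (2 * k + 1))⁻¹ *
      ∑ s : Finset.Icc (-(k : ℤ)) k → Fin S.b, G (S.branchPoint k s x) := rfl

theorem b_pow_pos (k : ℕ) : 0 < ((S.b : ℝ) ^ (2 * k + 1))⁻¹ :=
  inv_pos.2 (pow_pos (Nat.cast_pos.2 S.b_pos) _)

theorem branchAverage_mono_of_forall (k : ℕ) (G H : C(LatticeSpace, ℝ)) (x y : LatticeSpace)
    (h : ∀ s, G (S.branchPoint k s x) ≤ H (S.branchPoint k s y)) :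
    S.branchAverage k G x ≤ S.branchAverage k H y :=
  mul_le_mul_of_nonneg_left (Finset.sum_le_sum fun s _ => h s) (S.b_pow_pos k).le

theorem branchAverage_one (k : ℕ) : S.branchAverage k 1 = 1 := by
  ext x
  have : (S.b : ℝ) ^ (2 * k + 1) ≠ 0 := (inv_pos.1 (S.b_pow_pos k)).ne'
  simp only [branchAverage_apply, ContinuousMap.one_apply, Finset.sum_const, Finset.card_univ,
    S.card_branches, nsmul_eq_mul, mul_one, Nat.cast_pow]
  exact inv_mul_cancel₀ this

theorem branchAverage_le {k : ℕ} {G : C(LatticeSpace, ℝ)} {c : ℝ} (h : ∀ x, G x ≤ c)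
    (x : LatticeSpace) : S.branchAverage k G x ≤ c := by
  have := S.branchAverage_mono_of_forall k G (c • 1) x x (fun s => by simpa using h _)
  rw [map_smul, branchAverage_one] at this
  simpa using this

/-- Points agreeing on $\{-N,\dots,N\}$ are within $\theta^N$ times the diameter bound, and a nearby
Hölder function transfers this to `G`. -/
theorem exists_cylinder_approx (S : CoupledLattice) (G : C(LatticeSpace, ℝ)) {ε : ℝ} (hε : 0 < ε) :
    ∃ N : ℕ, ∀ x y : LatticeSpace, (∀ j ∈ Finset.Icc (-(N : ℤ)) N, x j = y j) →
      |G x - G y| ≤ ε := by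
  obtain ⟨ψ, ⟨C, hC, h⟩, hψ⟩ := S.exists_holder_near G (show 0 < ε / 3 by positivity)
  have hM := (((tendsto_pow_atTop_nhds_zero_of_lt_one S.θ_mem.1.le S.θ_mem.2).mul_const
    S.diamBound).rpow_const (Or.inr S.β_pos.le)).const_mul C
  rw [zero_mul, Real.zero_rpow S.β_pos.ne', mul_zero] at hM
  obtain ⟨N, hN⟩ := (hM.eventually (gt_mem_nhds (show 0 < ε / 3 by positivity))).exists
  refine ⟨N, fun x y hxy => ?_⟩
  have hd : S.d x y ≤ S.θ ^ N * S.diamBound := by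
    have h0 := (S.d_nonneg x y).trans (S.d_le_diamBound x y)
    refine S.d_le fun k => ?_
    by_cases hk : k ∈ Finset.Icc (-(N : ℤ)) N
    · rw [hxy k hk, S.dI_self, mul_zero]
      exact mul_nonneg (pow_pos S.θ_mem.1 _).le h0
    · have hkN : N ≤ k.natAbs := by
        rw [Finset.mem_Icc] at hk
        omega
      refine mul_le_mul ?_ (S.dI_le _ _) (S.dI_nonneg _ _) (pow_pos S.θ_mem.1 _).le
      exact pow_le_pow_of_le_one S.θ_mem.1.le S.θ_mem.2.le hkN
  have h1 : |ψ x - ψ y| ≤ ε / 3 := (h x y).trans <| le_trans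
    (mul_le_mul_of_nonneg_left (Real.rpow_le_rpow (S.d_nonneg x y) hd S.β_pos.le) hC) hN.le
  have h2 := abs_le.1 (((G - ψ).norm_coe_le_norm x).trans hψ.le)
  have h3 := abs_le.1 (((G - ψ).norm_coe_le_norm y).trans hψ.le)
  have h4 := abs_le.1 h1
  simp only [ContinuousMap.sub_apply] at h2 h3
  rw [abs_le]
  constructor <;> linarith [h2.1, h2.2, h3.1, h3.2, h4.1, h4.2]

/-- The average over the small window equals one over the large window with the extra branch choices
ignored. Corresponding points then agree on the small window, where `G` is almost determined. -/
theorem exists_branchAverage_near (G : C(LatticeSpace, ℝ)) {ε : ℝ} (hε : 0 < ε) :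
    ∃ N : ℕ, ∀ k ≥ N, ‖S.branchAverage k G - S.branchAverage N G‖ ≤ ε := by
  obtain ⟨N, hN⟩ := S.exists_cylinder_approx G hε
  refine ⟨N, fun k hk => (ContinuousMap.norm_le _ hε.le).2 fun x => ?_⟩
  have : Nonempty (Fin S.b) := ⟨⟨0, S.b_pos⟩⟩
  have hsub : ∀ j ∈ Finset.Icc (-(N : ℤ)) N, j ∈ Finset.Icc (-(k : ℤ)) k := fun j hj => by
    rw [Finset.mem_Icc] at hj ⊢
    omega
  let e : Finset.Icc (-(N : ℤ)) N → Finset.Icc (-(k : ℤ)) k := fun j => ⟨j, hsub j j.2⟩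
  have he : Function.Injective e := fun i j h => Subtype.ext (Subtype.mk.inj h)
  have e1 := average_comp_injective (β := Fin S.b) he (fun s => G (S.branchPoint N s x))
  rw [S.card_branches, S.card_branches, Nat.cast_pow, Nat.cast_pow] at e1
  rw [ContinuousMap.sub_apply, branchAverage_apply, branchAverage_apply, e1, ← mul_sub,
    ← Finset.sum_sub_distrib, Real.norm_eq_abs, abs_mul, abs_of_pos (S.b_pow_pos k),
    inv_mul_le_iff₀ (inv_pos.1 (S.b_pow_pos k))]
  refine (Finset.abs_sum_le_sum_abs _ _).trans ((Finset.sum_le_card_nsmul _ _ ε fun s _ => ?_).trans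
    (le_of_eq ?_))
  · refine hN _ _ fun j hj => ?_
    simp only [branchPoint, dif_pos hj, dif_pos (hsub j hj), Function.comp_apply, e]
  · rw [Finset.card_univ, S.card_branches, nsmul_eq_mul, Nat.cast_pow]

theorem exists_tendsto_branchAverage (G : C(LatticeSpace, ℝ)) :
    ∃ H, Tendsto (fun k => S.branchAverage k G) atTop (𝓝 H) := by
  apply cauchySeq_tendsto_of_complete
  rw [Metric.cauchySeq_iff']
  intro ε hε
  obtain ⟨N, hN⟩ := S.exists_branchAverage_near G (half_pos hε)
  exact ⟨N, fun k hk => by rw [dist_eq_norm]; exact (hN k hk).trans_lt (half_lt_self hε)⟩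

/-- The limit of the averages over the inverse branches on finite sublattices. -/
noncomputable def branchLimit : C(LatticeSpace, ℝ) →L[ℝ] C(LatticeSpace, ℝ) :=
  LinearMap.mkContinuous
    { toFun := fun G => (S.exists_tendsto_branchAverage G).choose
      map_add' := fun G H => tendsto_nhds_unique
        (S.exists_tendsto_branchAverage (G + H)).choose_spec <| by
          simpa only [map_add] using (S.exists_tendsto_branchAverage G).choose_spec.add
            (S.exists_tendsto_branchAverage H).choose_spec
      map_smul' := fun c G => tendsto_nhds_unique
        (S.exists_tendsto_branchAverage (c • G)).choose_spec <| by
          simpa only [map_smul, RingHom.id_apply] using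
            (S.exists_tendsto_branchAverage G).choose_spec.const_smul c }
    1 fun G => le_of_tendsto' (S.exists_tendsto_branchAverage G).choose_spec.norm fun k => by
      rw [one_mul, ContinuousMap.norm_le _ (norm_nonneg _)]
      intro x
      rw [Real.norm_eq_abs, abs_le]
      refine ⟨?_, S.branchAverage_le (fun y => (le_abs_self _).trans (G.norm_coe_le_norm y)) x⟩
      have := S.branchAverage_le (k := k) (G := -G) (c := ‖G‖)
        (fun y => (neg_le_abs _).trans (G.norm_coe_le_norm y)) x
      rw [map_neg, ContinuousMap.neg_apply] at this
      linarith

theorem tendsto_branchAverage (G : C(LatticeSpace, ℝ)) :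
    Tendsto (fun k => S.branchAverage k G) atTop (𝓝 (S.branchLimit G)) :=
  (S.exists_tendsto_branchAverage G).choose_spec

theorem tendsto_branchAverage_apply (G : C(LatticeSpace, ℝ)) (x : LatticeSpace) :
    Tendsto (fun k => S.branchAverage k G x) atTop (𝓝 (S.branchLimit G x)) :=
  ((continuous_eval_const x).tendsto _).comp (S.tendsto_branchAverage G)

theorem branchLimit_one : S.branchLimit 1 = 1 :=
  tendsto_nhds_unique (S.tendsto_branchAverage 1)
    (tendsto_const_nhds.congr fun k => (S.branchAverage_one k).symm)

theorem branchLimit_nonneg {G : C(LatticeSpace, ℝ)} (h : ∀ x, 0 ≤ G x) (x : LatticeSpace) :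
    0 ≤ S.branchLimit G x :=
  ge_of_tendsto' (S.tendsto_branchAverage_apply G x) fun k =>
    mul_nonneg (S.b_pow_pos k).le (Finset.sum_nonneg fun _ _ => h _)

theorem branchLimit_mono {G H : C(LatticeSpace, ℝ)} (h : ∀ x, G x ≤ H x) (x : LatticeSpace) :
    S.branchLimit G x ≤ S.branchLimit H x :=
  le_of_tendsto_of_tendsto' (S.tendsto_branchAverage_apply G x) (S.tendsto_branchAverage_apply H x)
    fun k => S.branchAverage_mono_of_forall k G H x x fun _ => h _

theorem branchLimit_pos {G : C(LatticeSpace, ℝ)} (h : ∀ x, 0 < G x) (x : LatticeSpace) :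
    0 < S.branchLimit G x := by
  obtain ⟨x₀, -, h₀⟩ := isCompact_univ.exists_isMinOn univ_nonempty G.continuous.continuousOn
  have h1 := S.branchLimit_mono (G := G x₀ • 1) (H := G) (fun y => by
    simpa using h₀ (mem_univ y)) x
  rw [map_smul, branchLimit_one] at h1
  exact (h x₀).trans_le (by simpa using h1)

/-- For each choice of branches the two preimages are $\eta$ times closer, which improves the
parameter by $\eta^\beta$; averaging and limits preserve the inequality. -/
theorem branchLimit_le_exp_mul {a : ℝ} (ha : 0 ≤ a) {G : C(LatticeSpace, ℝ)}
    (hG : G ∈ logCone S.dβ a) (x y : LatticeSpace) :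
    S.branchLimit G x ≤ Real.exp (a * S.η ^ S.β * S.dβ x y) * S.branchLimit G y := by
  refine le_of_tendsto_of_tendsto' (S.tendsto_branchAverage_apply G x)
    ((S.tendsto_branchAverage_apply G y).const_mul _) fun k => ?_
  have h := S.branchAverage_mono_of_forall k G (Real.exp (a * S.η ^ S.β * S.dβ x y) • G) x y
    (fun s => (hG.2 _ (S.branchPoint k s y)).trans (mul_le_mul_of_nonneg_right
      (Real.exp_le_exp.2 ?_) (hG.1 _).le))
  · simpa only [map_smul, ContinuousMap.smul_apply, smul_eq_mul] using h
  · rw [mul_assoc]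
    exact mul_le_mul_of_nonneg_left
      (S.dβ_le_of_d_le S.η_mem.1.le (S.d_branchPoint_le k s x y)) ha

theorem branchLimit_mem_logCone {a : ℝ} (ha : 0 ≤ a) {G : C(LatticeSpace, ℝ)}
    (hG : G ∈ logCone S.dβ a) : S.branchLimit G ∈ logCone S.dβ (a * S.η ^ S.β) :=
  ⟨S.branchLimit_pos hG.1, S.branchLimit_le_exp_mul ha hG⟩

end CoupledLattice

/-! ### Complex extension of real operators. -/

section Complexify

variable {X : Type*} [TopologicalSpace X]

/-- The real part of a continuous complex function. -/
noncomputable def reMap (Φ : C(X, ℂ)) : C(X, ℝ) :=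
  ⟨fun x => (Φ x).re, Complex.continuous_re.comp Φ.continuous⟩

/-- The imaginary part of a continuous complex function. -/
noncomputable def imMap (Φ : C(X, ℂ)) : C(X, ℝ) :=
  ⟨fun x => (Φ x).im, Complex.continuous_im.comp Φ.continuous⟩

/-- The continuous complex function with given real and imaginary parts. -/
noncomputable def complexMap (u v : C(X, ℝ)) : C(X, ℂ) :=
  ⟨fun x => ⟨u x, v x⟩, by
    have : (fun x => (⟨u x, v x⟩ : ℂ)) = fun x => (u x : ℂ) + v x * Complex.I := by
      funext x
      apply Complex.ext <;> simp
    rw [this]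
    fun_prop⟩

@[simp] theorem reMap_apply (Φ : C(X, ℂ)) (x : X) : reMap Φ x = (Φ x).re := rfl
@[simp] theorem imMap_apply (Φ : C(X, ℂ)) (x : X) : imMap Φ x = (Φ x).im := rfl
@[simp] theorem complexMap_apply (u v : C(X, ℝ)) (x : X) : complexMap u v x = ⟨u x, v x⟩ := rfl

theorem reMap_add (Φ Ψ : C(X, ℂ)) : reMap (Φ + Ψ) = reMap Φ + reMap Ψ := rfl
theorem imMap_add (Φ Ψ : C(X, ℂ)) : imMap (Φ + Ψ) = imMap Φ + imMap Ψ := rfl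
theorem reMap_smul (c : ℂ) (Φ : C(X, ℂ)) : reMap (c • Φ) = c.re • reMap Φ - c.im • imMap Φ := by
  ext x; simp
theorem imMap_smul (c : ℂ) (Φ : C(X, ℂ)) : imMap (c • Φ) = c.re • imMap Φ + c.im • reMap Φ := by
  ext x; simp

variable [CompactSpace X]

theorem norm_reMap_le (Φ : C(X, ℂ)) : ‖reMap Φ‖ ≤ ‖Φ‖ :=
  (ContinuousMap.norm_le _ (norm_nonneg _)).2 fun x =>
    (Complex.abs_re_le_norm _).trans (Φ.norm_coe_le_norm x)

theorem norm_imMap_le (Φ : C(X, ℂ)) : ‖imMap Φ‖ ≤ ‖Φ‖ :=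
  (ContinuousMap.norm_le _ (norm_nonneg _)).2 fun x =>
    (Complex.abs_im_le_norm _).trans (Φ.norm_coe_le_norm x)

theorem norm_complexMap_le (u v : C(X, ℝ)) : ‖complexMap u v‖ ≤ ‖u‖ + ‖v‖ :=
  (ContinuousMap.norm_le _ (by positivity)).2 fun x =>
    (Complex.norm_le_abs_re_add_abs_im _).trans
      (add_le_add (u.norm_coe_le_norm x) (v.norm_coe_le_norm x))

/-- The complex-linear extension of a real operator. -/
noncomputable def complexify (Q : C(X, ℝ) →L[ℝ] C(X, ℝ)) : C(X, ℂ) →L[ℂ] C(X, ℂ) :=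
  LinearMap.mkContinuous
    { toFun := fun Φ => complexMap (Q (reMap Φ)) (Q (imMap Φ))
      map_add' := fun Φ Ψ => by
        rw [reMap_add, imMap_add, map_add, map_add]
        rfl
      map_smul' := fun c Φ => by
        rw [reMap_smul, imMap_smul]
        ext x
        apply Complex.ext <;> simp }
    (‖Q‖ + ‖Q‖) fun Φ => by
      refine (norm_complexMap_le _ _).trans ?_
      rw [add_mul]
      exact add_le_add ((Q.le_opNorm _).trans (by gcongr; exact norm_reMap_le Φ))
        ((Q.le_opNorm _).trans (by gcongr; exact norm_imMap_le Φ))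

theorem complexify_apply (Q : C(X, ℝ) →L[ℝ] C(X, ℝ)) (Φ : C(X, ℂ)) :
    complexify Q Φ = complexMap (Q (reMap Φ)) (Q (imMap Φ)) := rfl

theorem complexify_pow_apply (Q : C(X, ℝ) →L[ℝ] C(X, ℝ)) (n : ℕ) (Φ : C(X, ℂ)) :
    (complexify Q)^[n] Φ = complexMap ((Q ^ n) (reMap Φ)) ((Q ^ n) (imMap Φ)) := by
  induction n with
  | zero => rfl
  | succ n ih =>
    rw [Function.iterate_succ_apply', ih, complexify_apply, pow_succ_apply', pow_succ_apply']
    rfl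

end Complexify

/-! ### Products and reciprocals of cone functions. -/

section ConeAlgebra

variable {X : Type*} [TopologicalSpace X] {δ : X → X → ℝ} {a b : ℝ}

theorem mul_mem_logCone {φ ψ : C(X, ℝ)} (hφ : φ ∈ logCone δ a) (hψ : ψ ∈ logCone δ b) :
    φ * ψ ∈ logCone δ (a + b) :=
  ⟨fun x => mul_pos (hφ.1 x) (hψ.1 x), fun x y => by
    rw [add_mul, Real.exp_add, ContinuousMap.mul_apply, ContinuousMap.mul_apply]
    calc φ x * ψ x ≤ (Real.exp (a * δ x y) * φ y) * (Real.exp (b * δ x y) * ψ y) :=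
          mul_le_mul (hφ.2 x y) (hψ.2 x y) (hψ.1 x).le
            (mul_pos (Real.exp_pos _) (hφ.1 y)).le
      _ = _ := by ring⟩

theorem inv_mem_logCone (hδ : ∀ x y, δ x y = δ y x) {φ ψ : C(X, ℝ)} (hφ : φ ∈ logCone δ a)
    (h : ∀ x, ψ x = (φ x)⁻¹) : ψ ∈ logCone δ a :=
  ⟨fun x => by rw [h]; exact inv_pos.2 (hφ.1 x), fun x y => by
    have h1 := hφ.2 y x
    rw [hδ y x] at h1
    have px := hφ.1 x
    have py := hφ.1 y
    rw [h, h, inv_le_comm₀ px (by positivity), mul_inv, inv_inv, ← Real.exp_neg, Real.exp_neg,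
      inv_mul_le_iff₀ (Real.exp_pos _)]
    exact h1⟩

end ConeAlgebra

/-! ### The transfer operators as cone contractions. -/

namespace CoupledLattice

variable (S : CoupledLattice)

/-- The exponential of a continuous function. -/
noncomputable def expMap (f : C(LatticeSpace, ℝ)) : C(LatticeSpace, ℝ) :=
  ⟨fun x => Real.exp (f x), Real.continuous_exp.comp f.continuous⟩

/-- The operator `φ ↦ P_f φ` on continuous real functions. -/
noncomputable def ruelleOp (f : C(LatticeSpace, ℝ)) : C(LatticeSpace, ℝ) →L[ℝ] C(LatticeSpace, ℝ) :=
  S.branchLimit.comp (ContinuousLinearMap.mul ℝ C(LatticeSpace, ℝ)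
    (expMap f))

/-- The operator `φ ↦ (v P_f (w φ)) ∘ E⁻¹` on continuous real functions. -/
noncomputable def coupledOp (f w v : C(LatticeSpace, ℝ)) :
    C(LatticeSpace, ℝ) →L[ℝ] C(LatticeSpace, ℝ) where
  toFun φ := (v * S.ruelleOp f (w * φ)).comp ⟨S.E.symm, S.continuous_E_symm⟩
  map_add' φ ψ := by
    ext x
    simp [mul_add]
  map_smul' c φ := by
    ext x
    simp
  cont := (ContinuousMap.continuous_precomp _).comp
    (continuous_const.mul ((S.ruelleOp f).continuous.comp (continuous_const.mul continuous_id)))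

theorem coupledOp_apply (f w v φ : C(LatticeSpace, ℝ)) (x : LatticeSpace) :
    S.coupledOp f w v φ x = v (S.E.symm x) * S.ruelleOp f (w * φ) (S.E.symm x) := rfl

theorem Pk_eq (f : C(LatticeSpace, ℝ)) (Φ : C(LatticeSpace, ℂ)) (k : ℕ) (x : LatticeSpace) :
    S.Pk f k Φ x = ⟨S.branchAverage k (expMap f * reMap Φ) x,
      S.branchAverage k (expMap f * imMap Φ) x⟩ := by
  have e : ((S.b : ℂ) ^ (2 * k + 1))⁻¹ = (((S.b : ℝ) ^ (2 * k + 1))⁻¹ : ℝ) := by push_cast; rfl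
  rw [Pk, e]
  apply Complex.ext
  · rw [Complex.re_ofReal_mul, Complex.re_sum]
    simp only [Complex.re_ofReal_mul]
    rfl
  · rw [Complex.im_ofReal_mul, Complex.im_sum]
    simp only [Complex.im_ofReal_mul]
    rfl

theorem tendsto_Pk (f : C(LatticeSpace, ℝ)) (Φ : C(LatticeSpace, ℂ)) (x : LatticeSpace) :
    Tendsto (fun k => S.Pk f k Φ x) atTop (𝓝 (complexify (S.ruelleOp f) Φ x)) := by
  have h1 := S.tendsto_branchAverage_apply (expMap f * reMap Φ) x
  have h2 := S.tendsto_branchAverage_apply (expMap f * imMap Φ) x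
  have h3 := (((Complex.continuous_ofReal.tendsto _).comp h1)).add
    (((Complex.continuous_ofReal.tendsto _).comp h2).mul_const Complex.I)
  have e : ∀ a b : ℝ, (⟨a, b⟩ : ℂ) = a + b * Complex.I := fun a b => by
    apply Complex.ext <;> simp
  simp only [Pk_eq, e, complexify_apply, complexMap_apply]
  exact h3

theorem P_eq (f : C(LatticeSpace, ℝ)) (Φ : C(LatticeSpace, ℂ)) (x : LatticeSpace) :
    S.P f Φ x = complexify (S.ruelleOp f) Φ x := (S.tendsto_Pk f Φ x).limUnder_eq

theorem P_ofReal (f φ : C(LatticeSpace, ℝ)) (x : LatticeSpace) :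
    S.P f (fun y => (φ y : ℂ)) x = S.ruelleOp f φ x := by
  have h := S.P_eq f ⟨fun y => (φ y : ℂ), Complex.continuous_ofReal.comp φ.continuous⟩ x
  have h1 : reMap (⟨fun y => (φ y : ℂ), Complex.continuous_ofReal.comp φ.continuous⟩ :
      C(LatticeSpace, ℂ)) = φ := by ext y; simp
  have h2 : imMap (⟨fun y => (φ y : ℂ), Complex.continuous_ofReal.comp φ.continuous⟩ :
      C(LatticeSpace, ℂ)) = 0 := by ext y; simp
  rw [complexify_apply, h1, h2, map_zero] at h
  exact h.trans (by apply Complex.ext <;> simp)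

theorem calL_eq (f h v : C(LatticeSpace, ℝ)) (lam : ℝ) (hv : ∀ x, v x = (lam * h x)⁻¹)
    (Φ : C(LatticeSpace, ℂ)) (x : LatticeSpace) :
    S.calL f lam h Φ x = complexify (S.coupledOp f h v) Φ x := by
  have hc : Continuous fun y => (h y : ℂ) * Φ y :=
    (Complex.continuous_ofReal.comp h.continuous).mul Φ.continuous
  have e := S.P_eq f ⟨fun y => (h y : ℂ) * Φ y, hc⟩ (S.E.symm x)
  have h1 : reMap (⟨fun y => (h y : ℂ) * Φ y, hc⟩ : C(LatticeSpace, ℂ)) = h * reMap Φ := by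
    ext y; simp
  have h2 : imMap (⟨fun y => (h y : ℂ) * Φ y, hc⟩ : C(LatticeSpace, ℂ)) = h * imMap Φ := by
    ext y; simp
  rw [complexify_apply, h1, h2] at e
  have e2 : S.calL f lam h Φ x = S.P f (fun y => (h y : ℂ) * Φ y) (S.E.symm x) /
    (lam * h (S.E.symm x)) := rfl
  rw [e2]
  refine (congrArg (· / ((lam : ℂ) * h (S.E.symm x))) e).trans ?_
  rw [complexify_apply, complexMap_apply, complexMap_apply, coupledOp_apply, coupledOp_apply, hv,
    ← Complex.ofReal_mul]
  apply Complex.ext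
  · rw [Complex.div_ofReal_re]
    simp only []
    rw [div_eq_inv_mul]
  · rw [Complex.div_ofReal_im]
    simp only []
    rw [div_eq_inv_mul]

theorem ruelleOp_nonneg (f : C(LatticeSpace, ℝ)) {φ : C(LatticeSpace, ℝ)} (h : ∀ x, 0 ≤ φ x)
    (x : LatticeSpace) : 0 ≤ S.ruelleOp f φ x :=
  S.branchLimit_nonneg (fun y => mul_nonneg (Real.exp_pos _).le (h y)) x

theorem ruelleOp_pos (f : C(LatticeSpace, ℝ)) {φ : C(LatticeSpace, ℝ)} (h : ∀ x, 0 < φ x)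
    (x : LatticeSpace) : 0 < S.ruelleOp f φ x :=
  S.branchLimit_pos (fun y => mul_pos (Real.exp_pos _) (h y)) x

theorem expMap_mem_logCone {f : C(LatticeSpace, ℝ)} (hf : S.InC f) :
    expMap f ∈ logCone S.dβ (S.holderConst f) :=
  ⟨fun _ => Real.exp_pos _, fun x y => by
    have := (abs_le.1 (hf.norm_sub_le x y)).2
    change Real.exp (f x) ≤ _ * Real.exp (f y)
    rw [← Real.exp_add]
    exact Real.exp_le_exp.2 (by linarith)⟩

theorem ruelleOp_mem_logCone {f : C(LatticeSpace, ℝ)} (hf : S.InC f) {a : ℝ} (ha : 0 ≤ a)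
    {φ : C(LatticeSpace, ℝ)} (hφ : φ ∈ logCone S.dβ a) :
    S.ruelleOp f φ ∈ logCone S.dβ ((S.holderConst f + a) * S.η ^ S.β) :=
  S.branchLimit_mem_logCone (add_nonneg S.holderConst_nonneg ha)
    (mul_mem_logCone (S.expMap_mem_logCone hf) hφ)

theorem η_rpow_pos : 0 < S.η ^ S.β := Real.rpow_pos_of_pos S.η_mem.1 _

theorem η_rpow_lt_one : S.η ^ S.β < 1 := Real.rpow_lt_one S.η_mem.1.le S.η_mem.2 S.β_pos

/-- The exponent `|f|_β η^β / (1 - η^β)` in the distortion bound. -/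
noncomputable def distortion (f : LatticeSpace → ℝ) : ℝ :=
  S.holderConst f * (S.η ^ S.β / (1 - S.η ^ S.β))

theorem distortion_nonneg (f : LatticeSpace → ℝ) : 0 ≤ S.distortion f :=
  mul_nonneg S.holderConst_nonneg (div_nonneg S.η_rpow_pos.le (by linarith [S.η_rpow_lt_one]))

/-- The distortion exponent is the fixed point of $a\mapsto(|f|_\beta+a)\eta^\beta$, the action of
$P$ on cone parameters. -/
theorem distortion_eq (f : LatticeSpace → ℝ) :
    (S.holderConst f + S.distortion f) * S.η ^ S.β = S.distortion f := by
  have : 1 - S.η ^ S.β ≠ 0 := by linarith [S.η_rpow_lt_one]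
  rw [distortion]
  field_simp
  ring

theorem isConeContraction_ruelleOp {f : C(LatticeSpace, ℝ)} (hf : S.InC f) :
    IsConeContraction S.dβ (S.diamBound ^ S.β) (S.distortion f + 1)
      (S.distortion f + S.η ^ S.β) (S.ruelleOp f) where
  δ_nonneg := S.dβ_nonneg
  δ_le := S.dβ_le
  δ_symm := S.dβ_symm
  nonneg := add_nonneg (S.distortion_nonneg f) S.η_rpow_pos.le
  lt := by linarith [S.η_rpow_lt_one]
  pos := fun _ h => S.ruelleOp_nonneg f h
  maps := fun φ hφ => by
    have h := S.ruelleOp_mem_logCone hf (by linarith [S.distortion_nonneg f]) hφ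
    rwa [← add_assoc, add_mul, S.distortion_eq, one_mul] at h

theorem coupledOp_mem_logCone {f w v : C(LatticeSpace, ℝ)} (hf : S.InC f)
    {a c : ℝ} (hc : 0 ≤ c) (hw : w ∈ logCone S.dβ c) (hv : v ∈ logCone S.dβ c) (ha : 0 ≤ a)
    {φ : C(LatticeSpace, ℝ)} (hφ : φ ∈ logCone S.dβ a) :
    S.coupledOp f w v φ ∈
      logCone S.dβ (S.CE ^ S.β * (c + (S.holderConst f + (c + a)) * S.η ^ S.β)) := by
  have h := mul_mem_logCone hv
    (S.ruelleOp_mem_logCone hf (add_nonneg hc ha) (mul_mem_logCone hw hφ))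
  refine ⟨fun x => h.1 _, fun x y => (h.2 _ _).trans (mul_le_mul_of_nonneg_right
    (Real.exp_le_exp.2 ?_) (h.1 _).le)⟩
  have h1 := S.dβ_le_of_d_le S.CE_mem.1.le (S.d_E_symm_le x y)
  have h2 : 0 ≤ c + (S.holderConst f + (c + a)) * S.η ^ S.β := by
    have := S.holderConst_nonneg (Φ := f)
    have := S.η_rpow_pos
    positivity
  calc _ ≤ (c + (S.holderConst f + (c + a)) * S.η ^ S.β) * (S.CE ^ S.β * S.dβ x y) :=
        mul_le_mul_of_nonneg_left h1 h2
    _ = _ := by ring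

/-- The assumption $C_E<\eta^{-1}$ enters here: the expansion of the branches outweighs the
coupling. -/
theorem CE_rpow_mul_lt_one : S.CE ^ S.β * S.η ^ S.β < 1 := by
  rw [← Real.mul_rpow S.CE_mem.1.le S.η_mem.1.le]
  refine Real.rpow_lt_one (mul_pos S.CE_mem.1 S.η_mem.1).le ?_ S.β_pos
  have h := mul_lt_mul_of_pos_right S.CE_mem.2 S.η_mem.1
  rwa [inv_mul_cancel₀ S.η_mem.1.ne'] at h

theorem exists_isConeContraction_coupledOp {f w v : C(LatticeSpace, ℝ)} (hf : S.InC f)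
    (hw : w ∈ logCone S.dβ (S.distortion f)) (hv : v ∈ logCone S.dβ (S.distortion f)) :
    ∃ a a', 0 < a ∧
      IsConeContraction S.dβ (S.diamBound ^ S.β) a a' (S.coupledOp f w v) := by
  have hB := S.distortion_nonneg f
  have hC : 0 < S.CE ^ S.β := Real.rpow_pos_of_pos S.CE_mem.1 _
  have hρ := S.CE_rpow_mul_lt_one
  have hη := S.η_rpow_pos
  set B := S.distortion f
  set C := S.CE ^ S.β
  -- The parameter `a` is sent to `C * (2 * B + a * η ^ β)`. The quotient is the fixed point of this
  -- map, and adding `1` makes the inclusion strict.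
  set a := C * (2 * B) / (1 - C * S.η ^ S.β) + 1 with ha
  have ha0 : 0 < a := by
    have : 0 < 1 - C * S.η ^ S.β := by linarith
    positivity
  have ha1 : a * (1 - C * S.η ^ S.β) = C * (2 * B) + (1 - C * S.η ^ S.β) := by
    rw [ha, add_mul, one_mul, div_mul_cancel₀ _ (by linarith)]
  refine ⟨a, C * (B + (S.holderConst f + (B + a)) * S.η ^ S.β), ha0, S.dβ_nonneg, S.dβ_le,
    S.dβ_symm, ?_, ?_, ?_, ?_⟩
  · have := S.holderConst_nonneg (Φ := f)
    positivity
  · rw [← add_assoc, add_mul, S.distortion_eq]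
    linarith
  · exact fun φ h x => mul_nonneg (hv.1 _).le
      (S.ruelleOp_nonneg f (fun y => mul_nonneg (hw.1 y).le (h y)) _)
  · exact fun φ hφ => S.coupledOp_mem_logCone hf hB hw hv ha0.le hφ

end CoupledLattice

/-! ### Complex measures, their integrals and the dual operator. -/

section ComplexMeasures

theorem integral_complexMap {X : Type*} [TopologicalSpace X] [CompactSpace X]
    [MeasurableSpace X] [BorelSpace X] (p : Measure X) [IsFiniteMeasure p] (u v : C(X, ℝ)) :
    ∫ x, complexMap u v x ∂p = ⟨∫ x, u x ∂p, ∫ x, v x ∂p⟩ := by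
  have e : ∀ a b : ℝ, (⟨a, b⟩ : ℂ) = a + b * Complex.I := fun a b => by
    apply Complex.ext <;> simp
  have hu := (continuousMap_integrable p u).ofReal (𝕜 := ℂ)
  have hv := ((continuousMap_integrable p v).ofReal (𝕜 := ℂ)).mul_const Complex.I
  have h1 : ∫ x, ((u x : ℝ) : ℂ) ∂p = (∫ x, u x ∂p : ℝ) := integral_ofReal
  have h2 : ∫ x, ((v x : ℝ) : ℂ) ∂p = (∫ x, v x ∂p : ℝ) := integral_ofReal
  simp only [complexMap_apply, e]
  rw [← h1, ← h2, ← integral_mul_const]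
  exact integral_add hu hv

/-- A finite measure, regarded as a complex measure. -/
noncomputable def finiteToComplex (p : Measure LatticeSpace) [IsFiniteMeasure p] :
    ComplexMeasure LatticeSpace :=
  p.toSignedMeasure.toComplexMeasure 0

theorem finiteToComplex_apply (p : Measure LatticeSpace) [IsFiniteMeasure p]
    {s : Set LatticeSpace} (hs : MeasurableSet s) : finiteToComplex p s = (p.real s : ℂ) := by
  rw [finiteToComplex, SignedMeasure.toComplexMeasure_apply,
    Measure.toSignedMeasure_apply_measurable hs]
  rfl

instance isFiniteMeasure_variation (μ : ComplexMeasure LatticeSpace) :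
    IsFiniteMeasure μ.variation := by
  have h : μ.variation ≤ (ComplexMeasure.re μ).totalVariation + (ComplexMeasure.im μ).totalVariation := by
    refine VectorMeasure.variation_le_of_forall_enorm_le fun s _ => ?_
    refine le_trans ?_ (add_le_add ((ComplexMeasure.re μ).enorm_le_totalVariation s)
      ((ComplexMeasure.im μ).enorm_le_totalVariation s))
    have e : μ s = ((ComplexMeasure.re μ s : ℝ) : ℂ) + (ComplexMeasure.im μ s : ℝ) * Complex.I := by
      apply Complex.ext <;> simp <;> rfl
    rw [e]
    refine (enorm_add_le _ _).trans (add_le_add (le_of_eq ?_) (le_of_eq ?_))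
    · rw [← ofReal_norm, ← ofReal_norm, Complex.norm_real]
    · rw [← ofReal_norm, ← ofReal_norm, norm_mul, Complex.norm_I, mul_one, Complex.norm_real]
  exact isFiniteMeasure_of_le _ h

theorem integrable_complexMeasure (μ : ComplexMeasure LatticeSpace) (φ : C(LatticeSpace, ℂ)) :
    μ.Integrable φ := continuousMap_integrable _ φ

/-- The domination hypothesis depends on the measure, so equal measures must be substituted before
the two integrals can be compared. -/
theorem setToFun_congr_of_measure_eq {α E F : Type*} [MeasurableSpace α] [NormedAddCommGroup E]
    [NormedSpace ℝ E] [NormedAddCommGroup F] [NormedSpace ℝ F] {m m' : Measure α} (h : m = m')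
    {T : Set α → E →L[ℝ] F} {C C' : ℝ} (hT : DominatedFinMeasAdditive m T C)
    (hT' : DominatedFinMeasAdditive m' T C') (f : α → E) :
    setToFun m T hT f = setToFun m' T hT' f := by
  subst h
  exact setToFun_congr_left _ _ rfl f

theorem variation_finiteToComplex (p : Measure LatticeSpace) [IsFiniteMeasure p] :
    (finiteToComplex p).variation = p := by
  have e : ∀ s, MeasurableSet s → ‖finiteToComplex p s‖ₑ = p s := fun s hs => by
    rw [finiteToComplex_apply p hs, ← ofReal_norm, Complex.norm_real, Real.norm_eq_abs,
      abs_of_nonneg measureReal_nonneg, ofReal_measureReal]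
  apply le_antisymm
  · exact VectorMeasure.variation_le_of_forall_enorm_le fun s hs => (e s hs).le
  · refine Measure.le_iff.2 fun s hs => ?_
    rw [← e s hs]
    exact VectorMeasure.enorm_measure_le_variation _ _

theorem complexIntegral_finiteToComplex (p : Measure LatticeSpace) [IsFiniteMeasure p]
    (φ : LatticeSpace → ℂ) : complexIntegral (finiteToComplex p) φ = ∫ x, φ x ∂p := by
  have hd' : ∀ m : Measure LatticeSpace, (finiteToComplex p).variation = m →
      DominatedFinMeasAdditive m ((finiteToComplex p).transpose (ContinuousLinearMap.mul ℝ ℂ))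
        ‖ContinuousLinearMap.mul ℝ ℂ‖ := by
    rintro _ rfl
    exact dominatedFinMeasAdditive_cbmApplyMeasure _ _
  rw [complexIntegral, VectorMeasure.integral_eq_setToFun, MeasureTheory.integral_eq_setToFun,
    setToFun_congr_of_measure_eq (variation_finiteToComplex p) _
      (hd' _ (variation_finiteToComplex p))]
  refine setToFun_congr_left' _ _ (fun s hs _ => ?_) φ
  refine ContinuousLinearMap.ext fun x => ?_
  rw [transpose_eq_cbmApplyMeasure, cbmApplyMeasure_apply,
    finiteToComplex_apply p hs, weightedSMul_apply, ContinuousLinearMap.mul_apply',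
    Complex.real_smul, mul_comm]

theorem complexIntegral_add (μ μ' : ComplexMeasure LatticeSpace) (φ : C(LatticeSpace, ℂ)) :
    complexIntegral (μ + μ') φ = complexIntegral μ φ + complexIntegral μ' φ :=
  VectorMeasure.integral_add_vectorMeasure (integrable_complexMeasure μ φ)
    (integrable_complexMeasure μ' φ)

theorem complexIntegral_sub (μ μ' : ComplexMeasure LatticeSpace) (φ : C(LatticeSpace, ℂ)) :
    complexIntegral (μ - μ') φ = complexIntegral μ φ - complexIntegral μ' φ :=
  VectorMeasure.integral_sub_vectorMeasure (integrable_complexMeasure μ φ)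
    (integrable_complexMeasure μ' φ)

/-- The integral is built from a real bilinear product, so compatibility with `Complex.I` is checked
on indicators and extended by density; `μ` and `Complex.I • μ` have the same variation. -/
theorem complexIntegral_I_smul (μ : ComplexMeasure LatticeSpace) (φ : C(LatticeSpace, ℂ)) :
    complexIntegral (Complex.I • μ) φ = Complex.I * complexIntegral μ φ := by
  have hv : (Complex.I • μ).variation = μ.variation := by
    rw [VectorMeasure.variation_smul]
    simp
  have hd' : ∀ m : Measure LatticeSpace, (Complex.I • μ).variation = m →
      DominatedFinMeasAdditive m ((Complex.I • μ).transpose (ContinuousLinearMap.mul ℝ ℂ))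
        ‖ContinuousLinearMap.mul ℝ ℂ‖ := by
    rintro _ rfl
    exact dominatedFinMeasAdditive_cbmApplyMeasure _ _
  have hd := dominatedFinMeasAdditive_cbmApplyMeasure μ (ContinuousLinearMap.mul ℝ ℂ)
  rw [complexIntegral, complexIntegral, VectorMeasure.integral_eq_setToFun,
    VectorMeasure.integral_eq_setToFun, setToFun_congr_of_measure_eq hv _ (hd' _ hv)]
  refine Integrable.induction (fun g => setToFun μ.variation _ (hd' _ hv) g =
    Complex.I * setToFun μ.variation _ hd g) ?_ ?_ ?_ ?_ (integrable_complexMeasure μ φ)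
  · intro c s hs hfin
    rw [setToFun_indicator_const _ hs hfin.ne, setToFun_indicator_const _ hs hfin.ne,
      transpose_eq_cbmApplyMeasure, transpose_eq_cbmApplyMeasure,
      cbmApplyMeasure_apply, cbmApplyMeasure_apply, ContinuousLinearMap.mul_apply',
      ContinuousLinearMap.mul_apply', smul_apply, smul_eq_mul]
    ring
  · intro g g' _ hg hg' h h'
    rw [setToFun_add _ hg hg', setToFun_add _ hg hg', h, h', mul_add]
  · exact isClosed_eq (continuous_setToFun _) (continuous_const.mul (continuous_setToFun _))
  · intro g g' hgg' _ h
    rw [← setToFun_congr_ae _ hgg', ← setToFun_congr_ae _ hgg', h]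

theorem complexIntegral_smul (c : ℂ) (μ : ComplexMeasure LatticeSpace) (φ : C(LatticeSpace, ℂ)) :
    complexIntegral (c • μ) φ = c * complexIntegral μ φ := by
  have hr : ∀ (r : ℝ) (μ : ComplexMeasure LatticeSpace),
      complexIntegral (r • μ) φ = r * complexIntegral μ φ := fun r μ =>
    (VectorMeasure.integral_smul_vectorMeasure (B := ContinuousLinearMap.mul ℝ ℂ) (μ := μ)
      (φ : LatticeSpace → ℂ) r).trans (Complex.real_smul ..)
  have e : c • μ = c.re • μ + c.im • (Complex.I • μ) := by
    refine VectorMeasure.ext fun s _ => ?_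
    simp only [smul_apply, add_apply, smul_eq_mul, Complex.real_smul]
    conv_lhs => rw [← Complex.re_add_im c]
    ring
  rw [e, complexIntegral_add, hr, hr, complexIntegral_I_smul]
  conv_rhs => rw [← Complex.re_add_im c]
  ring

theorem exists_finiteToComplex_decomposition (μ : ComplexMeasure LatticeSpace) :
    ∃ p : Fin 4 → FiniteMeasure LatticeSpace,
      μ = (finiteToComplex (p 0) - finiteToComplex (p 1)) +
        Complex.I • (finiteToComplex (p 2) - finiteToComplex (p 3)) := by
  let j := (ComplexMeasure.re μ).toJordanDecomposition
  let j' := (ComplexMeasure.im μ).toJordanDecomposition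
  refine ⟨![⟨j.posPart, inferInstance⟩, ⟨j.negPart, inferInstance⟩, ⟨j'.posPart, inferInstance⟩,
    ⟨j'.negPart, inferInstance⟩], VectorMeasure.ext fun s hs => ?_⟩
  have h1 : ComplexMeasure.re μ s = j.posPart.real s - j.negPart.real s := by
    rw [← Measure.toSignedMeasure_sub_apply hs]
    exact congrArg (fun q => q s) (SignedMeasure.toSignedMeasure_toJordanDecomposition _).symm
  have h2 : ComplexMeasure.im μ s = j'.posPart.real s - j'.negPart.real s := by
    rw [← Measure.toSignedMeasure_sub_apply hs]
    exact congrArg (fun q => q s) (SignedMeasure.toSignedMeasure_toJordanDecomposition _).symm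
  have e : μ s = ((ComplexMeasure.re μ s : ℝ) : ℂ) + Complex.I * (ComplexMeasure.im μ s : ℝ) := by
    apply Complex.ext <;> simp <;> rfl
  rw [e, h1, h2, add_apply, smul_apply, sub_apply,
    sub_apply, finiteToComplex_apply _ hs, finiteToComplex_apply _ hs,
    finiteToComplex_apply _ hs, finiteToComplex_apply _ hs, smul_eq_mul]
  push_cast
  rfl

theorem complexIntegral_decomposition (p : Fin 4 → FiniteMeasure LatticeSpace)
    (φ : C(LatticeSpace, ℂ)) :
    complexIntegral ((finiteToComplex (p 0) - finiteToComplex (p 1)) +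
        Complex.I • (finiteToComplex (p 2) - finiteToComplex (p 3))) φ =
      (∫ x, φ x ∂(p 0 : Measure LatticeSpace) - ∫ x, φ x ∂(p 1 : Measure LatticeSpace)) +
        Complex.I * (∫ x, φ x ∂(p 2 : Measure LatticeSpace) -
          ∫ x, φ x ∂(p 3 : Measure LatticeSpace)) := by
  rw [complexIntegral_add, complexIntegral_I_smul, complexIntegral_sub, complexIntegral_sub]
  simp only [complexIntegral_finiteToComplex]

theorem finiteMeasure_eq_of_integral_eq (p q : Measure LatticeSpace) [IsFiniteMeasure p]
    [IsFiniteMeasure q] (h : ∀ φ : C(LatticeSpace, ℝ), ∫ x, φ x ∂p = ∫ x, φ x ∂q) : p = q :=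
  ext_of_forall_integral_eq_of_IsFiniteMeasure fun φ => h φ.toContinuousMap

/-- A complex measure is determined by the integrals of continuous functions. -/
theorem complexMeasure_eq_of_complexIntegral_eq {μ μ' : ComplexMeasure LatticeSpace}
    (h : ∀ φ : C(LatticeSpace, ℂ), complexIntegral μ φ = complexIntegral μ' φ) : μ = μ' := by
  rw [← sub_eq_zero]
  obtain ⟨p, hp⟩ := exists_finiteToComplex_decomposition (μ - μ')
  have h0 : ∀ φ : C(LatticeSpace, ℂ), complexIntegral (μ - μ') φ = 0 := fun φ => by
    rw [complexIntegral_sub, h, sub_self]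
  have hr : ∀ u : C(LatticeSpace, ℝ),
      ∫ x, u x ∂(p 0 : Measure LatticeSpace) = ∫ x, u x ∂(p 1 : Measure LatticeSpace) ∧
      ∫ x, u x ∂(p 2 : Measure LatticeSpace) = ∫ x, u x ∂(p 3 : Measure LatticeSpace) := by
    intro u
    have h1 := h0 (complexMap u 0)
    rw [hp, complexIntegral_decomposition] at h1
    simp only [integral_complexMap] at h1
    have h2 := congrArg Complex.re h1
    have h3 := congrArg Complex.im h1
    simp at h2 h3
    exact ⟨by linarith, by linarith⟩
  have e1 : (p 0 : Measure LatticeSpace) = p 1 :=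
    finiteMeasure_eq_of_integral_eq _ _ fun u => (hr u).1
  have e2 : (p 2 : Measure LatticeSpace) = p 3 :=
    finiteMeasure_eq_of_integral_eq _ _ fun u => (hr u).2
  rw [hp]
  simp only [e1, e2, sub_self, smul_zero, add_zero]

/-- The dual of a positive operator, acting on finite measures. -/
theorem exists_dual_finiteMeasure {Q : C(LatticeSpace, ℝ) →L[ℝ] C(LatticeSpace, ℝ)}
    (hQ : ∀ φ : C(LatticeSpace, ℝ), (∀ x, 0 ≤ φ x) → ∀ x, 0 ≤ Q φ x)
    (p : FiniteMeasure LatticeSpace) : ∃ q : FiniteMeasure LatticeSpace,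
      ∀ φ : C(LatticeSpace, ℂ), ∫ x, φ x ∂(q : Measure LatticeSpace) =
        ∫ x, complexify Q φ x ∂(p : Measure LatticeSpace) := by
  let Λ : C(LatticeSpace, ℝ) →ₗ[ℝ] ℝ :=
    { toFun := fun φ => ∫ x, Q φ x ∂(p : Measure LatticeSpace)
      map_add' := fun φ ψ => by
        rw [map_add]
        exact integral_add (continuousMap_integrable _ _) (continuousMap_integrable _ _)
      map_smul' := fun c φ => by
        rw [map_smul]
        exact integral_const_mul _ _ }
  obtain ⟨q, hq, h⟩ := exists_measure_of_positive Λ fun φ hφ => integral_nonneg (hQ φ hφ)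
  refine ⟨⟨q, hq⟩, fun φ => ?_⟩
  rw [complexify_apply, integral_complexMap]
  have e : φ = complexMap (reMap φ) (imMap φ) := rfl
  conv_lhs => rw [e]
  refine (integral_complexMap q _ _).trans ?_
  rw [h, h]
  rfl

/-- The dual of a positive operator, acting on complex measures. -/
theorem exists_dual_complexMeasure {Q : C(LatticeSpace, ℝ) →L[ℝ] C(LatticeSpace, ℝ)}
    (hQ : ∀ φ : C(LatticeSpace, ℝ), (∀ x, 0 ≤ φ x) → ∀ x, 0 ≤ Q φ x) :
    ∃ D : ComplexMeasure LatticeSpace →ₗ[ℂ] ComplexMeasure LatticeSpace,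
      ∀ (μ : ComplexMeasure LatticeSpace) (φ : C(LatticeSpace, ℂ)),
        complexIntegral (D μ) φ = complexIntegral μ (complexify Q φ) := by
  have hex : ∀ μ : ComplexMeasure LatticeSpace, ∃ μ' : ComplexMeasure LatticeSpace,
      ∀ φ : C(LatticeSpace, ℂ), complexIntegral μ' φ = complexIntegral μ (complexify Q φ) := by
    intro μ
    obtain ⟨p, rfl⟩ := exists_finiteToComplex_decomposition μ
    choose q hq using exists_dual_finiteMeasure hQ
    refine ⟨_, fun φ => (complexIntegral_decomposition (fun i => q (p i)) φ).trans ?_⟩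
    rw [complexIntegral_decomposition]
    simp only [hq]
  -- Linearity is automatic, since integrals of continuous functions determine a complex measure.
  choose D hD using hex
  exact ⟨{
    toFun := D
    map_add' := fun μ μ' => complexMeasure_eq_of_complexIntegral_eq fun φ => by
      simp only [complexIntegral_add, hD]
    map_smul' := fun c μ => complexMeasure_eq_of_complexIntegral_eq fun φ => by
      simp only [complexIntegral_smul, hD, RingHom.id_apply] }, hD⟩

end ComplexMeasures

/-! ### Normalized contractions: convergence, invariance, uniqueness. -/

namespace IsConeContraction

variable {X : Type*} [TopologicalSpace X] [CompactSpace X] {δ : X → X → ℝ} {D a a' : ℝ}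
  {Q : C(X, ℝ) →L[ℝ] C(X, ℝ)} [T2Space X] [MeasurableSpace X] [BorelSpace X] [Nonempty X]

/-- The iterates of a normalized cone contraction converge to an integral. -/
theorem exists_tendsto_integral (hQ : IsConeContraction δ D a a' Q) (h1 : Q 1 = 1)
    (hd : ∀ φ : C(X, ℝ), ∀ ε > 0, ∃ φ' ∈ logCone δ a, ∃ c : ℝ, ∀ x, |φ x - (φ' x - c)| ≤ ε) :
    ∃ ν : ProbabilityMeasure X, ∀ φ : C(X, ℝ),
      Tendsto (fun n => (Q ^ n) φ) atTop (𝓝 ((∫ x, φ x ∂(ν : Measure X)) • 1)) := by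
  obtain ⟨ν, hν⟩ := hQ.exists_limit_measure hd
  have hn : ∀ n : ℕ, (Q ^ n) 1 = 1 := fun n => by
    induction n with
    | zero => rfl
    | succ n ih => rw [pow_succ_apply, h1, ih]
  refine ⟨ν, fun φ => ?_⟩
  rw [Metric.tendsto_atTop]
  intro ε hε
  obtain ⟨N, hN⟩ := hν φ (ε / 2) (half_pos hε)
  refine ⟨N, fun n hnN => ?_⟩
  rw [dist_eq_norm]
  refine lt_of_le_of_lt ((ContinuousMap.norm_le _ (half_pos hε).le).2 fun x => ?_) (half_lt_self hε)
  have := hN n hnN x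
  rw [hn] at this
  simpa using this

end IsConeContraction

section

variable {X : Type*} [TopologicalSpace X] [CompactSpace X] [MeasurableSpace X]

theorem tendsto_integral_of_tendsto [BorelSpace X] (ν : Measure X) [IsProbabilityMeasure ν] {φ : ℕ → C(X, ℝ)}
    {ψ : C(X, ℝ)} (h : Tendsto φ atTop (𝓝 ψ)) :
    Tendsto (fun n => ∫ x, φ n x ∂ν) atTop (𝓝 (∫ x, ψ x ∂ν)) := by
  have hc : Continuous fun φ : C(X, ℝ) => ∫ x, φ x ∂ν := by
    refine (LipschitzWith.of_dist_le_mul (K := 1) fun φ ψ => ?_).continuous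
    rw [Real.dist_eq, ← integral_sub (continuousMap_integrable _ φ) (continuousMap_integrable _ ψ),
      dist_eq_norm, NNReal.coe_one, one_mul]
    refine (norm_integral_le_of_norm_le_const (C := ‖φ - ψ‖) (.of_forall fun x =>
      (φ - ψ).norm_coe_le_norm x)).trans (by simp)
  exact (hc.tendsto ψ).comp h

variable {Q : C(X, ℝ) →L[ℝ] C(X, ℝ)} {ν : Measure X}

/-- The sequences $Q^n(Q\varphi)$ and $Q^{n+1}\varphi$ coincide, so their limiting constants do. -/
theorem integral_apply_eq_of_tendsto [Nonempty X]
    (h : ∀ φ : C(X, ℝ), Tendsto (fun n => (Q ^ n) φ) atTop (𝓝 ((∫ x, φ x ∂ν) • 1)))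
    (φ : C(X, ℝ)) : ∫ x, Q φ x ∂ν = ∫ x, φ x ∂ν := by
  obtain ⟨x⟩ := ‹Nonempty X›
  have h1 := h (Q φ)
  have h2 := (h φ).comp (tendsto_add_atTop_nat 1)
  have h3 := tendsto_nhds_unique (h1.congr fun n => (pow_succ_apply Q n φ).symm) h2
  simpa using congrArg (fun q : C(X, ℝ) => q x) h3

/-- Integrating $Q^n\varphi\to\int\varphi\,d\nu$ against an invariant `ν'` gives a constant sequence
on the left. -/
theorem integral_eq_of_invariant [BorelSpace X]
    (h : ∀ φ : C(X, ℝ), Tendsto (fun n => (Q ^ n) φ) atTop (𝓝 ((∫ x, φ x ∂ν) • 1)))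
    (ν' : Measure X) [IsProbabilityMeasure ν'] (h' : ∀ φ : C(X, ℝ), ∫ x, Q φ x ∂ν' = ∫ x, φ x ∂ν')
    (φ : C(X, ℝ)) : ∫ x, φ x ∂ν' = ∫ x, φ x ∂ν := by
  have h1 := tendsto_integral_of_tendsto ν' (h φ)
  have h2 : ∀ n : ℕ, ∫ x, (Q ^ n) φ x ∂ν' = ∫ x, φ x ∂ν' := fun n => by
    induction n with
    | zero => rfl
    | succ n ih => rw [pow_succ_apply', h', ih]
  simp only [h2] at h1
  have h3 := tendsto_nhds_unique tendsto_const_nhds h1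
  simpa using h3

end

/-! ### Eigendata and the normalized coupled operator. -/

namespace CoupledLattice

variable (S : CoupledLattice)

theorem exists_isEigendata {f : C(LatticeSpace, ℝ)} (hf : S.InC f) :
    ∃ (lam : ℝ) (ν₀ : Measure LatticeSpace) (h : LatticeSpace → ℝ), S.IsEigendata f lam ν₀ h := by
  have hQ := S.isConeContraction_ruelleOp hf
  have hB := S.distortion_nonneg f
  obtain ⟨lam, ν, h, hlam, hdual, heig, hint, hlim⟩ :=
    hQ.exists_eigendata (S.logCone_dense (by linarith))
  -- The contraction uses a parameter larger than `S.distortion f`, but the orbit of `1` stays in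
  -- the cone of exactly this parameter, which gives `h` the required distortion bound in the limit.
  have hmem : ∀ n : ℕ, (lam ^ n)⁻¹ • (S.ruelleOp f ^ n) 1 ∈ logCone S.dβ (S.distortion f) := by
    intro n
    refine smul_mem_logCone (by positivity) ?_
    induction n with
    | zero => exact one_mem_logCone S.dβ_nonneg hB
    | succ n ih =>
      rw [pow_succ_apply', ← S.distortion_eq f]
      exact S.ruelleOp_mem_logCone hf hB ih
  have hx := fun x => ((continuous_eval_const x).tendsto h).comp hlim
  refine ⟨lam, ν, h, inferInstance, fun Φ hΦ => ?_, ⟨h.continuous, fun x => ?_, hint,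
    fun x y => ?_⟩, fun x => ?_⟩
  · have e : ∀ x, S.P f Φ x = _ := S.P_eq f ⟨Φ, hΦ.1⟩
    simp only [e, complexify_apply]
    rw [integral_complexMap, hdual, hdual]
    have e2 := integral_complexMap (ν : Measure LatticeSpace) (reMap ⟨Φ, hΦ.1⟩) (imMap ⟨Φ, hΦ.1⟩)
    have e3 : ∫ x, Φ x ∂(ν : Measure LatticeSpace) = _ := e2
    rw [e3]
    apply Complex.ext <;> simp
  · exact ge_of_tendsto' (hx x) fun n => ((hmem n).1 x).le
  · exact le_of_tendsto_of_tendsto' (hx x) ((hx y).const_mul _) fun n => (hmem n).2 x y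
  · rw [P_ofReal, heig]
    simp

variable {S}

/-- By the distortion bound a zero of `h` would make it vanish identically, against $\int
h\,d\nu_0=1$. Then $Ph>0$ forces $\lambda>0$. -/
theorem IsEigendata.pos {f h : C(LatticeSpace, ℝ)} {lam : ℝ} {ν₀ : Measure LatticeSpace}
    (he : S.IsEigendata f lam ν₀ h) : 0 < lam ∧ ∀ x, 0 < h x := by
  obtain ⟨-, h0, hint, hle⟩ := he.mem
  have hpos : ∀ x, 0 < h x := fun y => by
    refine (h0 y).lt_of_ne fun hy => ?_
    have hz : ∀ x, h x = 0 := fun x => le_antisymm (by simpa [← hy] using hle x y) (h0 x)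
    simp [hz] at hint
  refine ⟨?_, hpos⟩
  have h1 := S.ruelleOp_pos f hpos (fun _ => 0)
  have h2 := he.eigen (fun _ => 0)
  rw [P_ofReal] at h2
  norm_cast at h2
  rw [h2] at h1
  exact pos_of_mul_pos_left h1 (hpos _).le

theorem IsEigendata.mem_logCone {f h : C(LatticeSpace, ℝ)} {lam : ℝ} {ν₀ : Measure LatticeSpace}
    (he : S.IsEigendata f lam ν₀ h) : h ∈ logCone S.dβ (S.distortion f) :=
  ⟨he.pos.2, he.mem.2.2.2⟩

theorem IsEigendata.ruelleOp_eq {f h : C(LatticeSpace, ℝ)} {lam : ℝ} {ν₀ : Measure LatticeSpace}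
    (he : S.IsEigendata f lam ν₀ h) (x : LatticeSpace) : S.ruelleOp f h x = lam * h x := by
  have h2 := he.eigen x
  rw [P_ofReal] at h2
  exact_mod_cast h2

/-- The normalization of the transfer operator of the coupled map is a cone contraction. -/
theorem IsEigendata.exists_coupledOp {f h : C(LatticeSpace, ℝ)} {lam : ℝ}
    {ν₀ : Measure LatticeSpace} (hf : S.InC f) (he : S.IsEigendata f lam ν₀ h) :
    ∃ (Q : C(LatticeSpace, ℝ) →L[ℝ] C(LatticeSpace, ℝ)) (a a' : ℝ), 0 < a ∧
      IsConeContraction S.dβ (S.diamBound ^ S.β) a a' Q ∧ Q 1 = 1 ∧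
      ∀ Φ : C(LatticeSpace, ℂ), S.calL f lam h Φ = complexify Q Φ := by
  obtain ⟨hlam, hpos⟩ := he.pos
  let v : C(LatticeSpace, ℝ) := ⟨fun x => (lam * h x)⁻¹,
    (continuous_const.mul h.continuous).inv₀ fun x => (mul_pos hlam (hpos x)).ne'⟩
  have hv : ∀ x, v x = (lam * h x)⁻¹ := fun _ => rfl
  obtain ⟨a, a', ha, hQ⟩ := S.exists_isConeContraction_coupledOp hf he.mem_logCone
    (inv_mem_logCone S.dβ_symm (smul_mem_logCone hlam he.mem_logCone) hv)
  refine ⟨_, a, a', ha, hQ, ?_, fun Φ => funext fun x => S.calL_eq f h v lam hv Φ x⟩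
  ext x
  rw [coupledOp_apply, mul_one, he.ruelleOp_eq, hv]
  exact inv_mul_cancel₀ (mul_pos hlam (hpos _)).ne'

variable (S)

/-- A cone contraction preserves Hölder continuity. -/
theorem holder_apply {Q : C(LatticeSpace, ℝ) →L[ℝ] C(LatticeSpace, ℝ)} {D a a' : ℝ} (ha : 0 < a)
    (hQ : IsConeContraction S.dβ D a a' Q) (h1 : Q 1 = 1) (φ : C(LatticeSpace, ℝ)) {C : ℝ}
    (hC : 0 ≤ C) (h : ∀ x y, ‖φ x - φ y‖ ≤ C * S.dβ x y) :
    ∃ C', 0 ≤ C' ∧ ∀ x y, ‖Q φ x - Q φ y‖ ≤ C' * S.dβ x y := by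
  -- The shift into the cone is harmless, because `Q 1 = 1` and constants cancel in differences.
  obtain ⟨c, hc⟩ := S.exists_add_const_mem_logCone ha φ hC h
  obtain ⟨C', hC', h'⟩ := S.norm_sub_le_of_mem_logCone hQ.nonneg (hQ.maps _ hc)
  refine ⟨C', hC', fun x y => ?_⟩
  have := h' x y
  rw [map_add, map_smul, h1] at this
  simpa using this

theorem inC_complexMap {u v : C(LatticeSpace, ℝ)}
    (hu : ∃ C, 0 ≤ C ∧ ∀ x y, ‖u x - u y‖ ≤ C * S.dβ x y)
    (hv : ∃ C, 0 ≤ C ∧ ∀ x y, ‖v x - v y‖ ≤ C * S.dβ x y) : S.InC (complexMap u v) := by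
  obtain ⟨C, hC, h⟩ := hu
  obtain ⟨C', hC', h'⟩ := hv
  refine S.inC_of_norm_sub_le (complexMap u v).continuous (add_nonneg hC hC') fun x y => ?_
  rw [add_mul]
  exact (Complex.norm_le_abs_re_add_abs_im _).trans (add_le_add (h x y) (h' x y))

theorem inC_complexify {Q : C(LatticeSpace, ℝ) →L[ℝ] C(LatticeSpace, ℝ)} {D a a' : ℝ} (ha : 0 < a)
    (hQ : IsConeContraction S.dβ D a a' Q) (h1 : Q 1 = 1) (Φ : C(LatticeSpace, ℂ))
    (hΦ : S.InC Φ) : S.InC (complexify Q Φ) :=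
  S.inC_complexMap
    (S.holder_apply ha hQ h1 _ S.holderConst_nonneg fun x y =>
      (Complex.abs_re_le_norm (Φ x - Φ y)).trans (hΦ.norm_sub_le x y))
    (S.holder_apply ha hQ h1 _ S.holderConst_nonneg fun x y =>
      (Complex.abs_im_le_norm (Φ x - Φ y)).trans (hΦ.norm_sub_le x y))

theorem dense_inC : Dense {Φ : C(LatticeSpace, ℂ) | S.InC Φ} := by
  rw [Metric.dense_iff]
  intro Φ r hr
  obtain ⟨u, hu, hu'⟩ := S.exists_holder_near (reMap Φ) (half_pos hr)
  obtain ⟨v, hv, hv'⟩ := S.exists_holder_near (imMap Φ) (half_pos hr)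
  refine ⟨complexMap u v, ?_, S.inC_complexMap hu hv⟩
  have e : Φ - complexMap u v = complexMap (reMap Φ - u) (imMap Φ - v) := by
    ext x
    apply Complex.ext <;> simp
  rw [Metric.mem_ball', dist_eq_norm, e]
  linarith [norm_complexMap_le (reMap Φ - u) (imMap Φ - v)]

theorem iterate_calL_eq {f : LatticeSpace → ℝ} {lam : ℝ} {h : LatticeSpace → ℝ}
    {M : C(LatticeSpace, ℂ) → C(LatticeSpace, ℂ)}
    (hM : ∀ Φ : C(LatticeSpace, ℂ), S.calL f lam h Φ = M Φ) (n : ℕ) (Φ : C(LatticeSpace, ℂ)) :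
    (S.calL f lam h)^[n] Φ = M^[n] Φ := by
  induction n with
  | zero => rfl
  | succ n ih => rw [Function.iterate_succ_apply', ih, hM, Function.iterate_succ_apply']

end CoupledLattice

/-! ### Passage to complex functions, eigenvalues of modulus one, and assembly. -/

theorem integral_eq_of_complexIntegral_eq {Q : C(LatticeSpace, ℝ) →L[ℝ] C(LatticeSpace, ℝ)}
    {ν : ProbabilityMeasure LatticeSpace}
    (h : ∀ φ : C(LatticeSpace, ℂ), complexIntegral (probToComplex ν) φ =
      complexIntegral (probToComplex ν) (complexify Q φ)) (u : C(LatticeSpace, ℝ)) :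
    ∫ x, Q u x ∂(ν : Measure LatticeSpace) = ∫ x, u x ∂(ν : Measure LatticeSpace) := by
  have e : ∀ φ : LatticeSpace → ℂ, complexIntegral (probToComplex ν) φ =
    ∫ x, φ x ∂(ν : Measure LatticeSpace) := complexIntegral_finiteToComplex _
  have h1 := h (complexMap u 0)
  rw [e, e, complexify_apply, integral_complexMap, integral_complexMap] at h1
  exact (congrArg Complex.re h1).symm

/-- Uniform convergence of the iterates on complex functions. -/
theorem tendstoUniformly_complexify {Q : C(LatticeSpace, ℝ) →L[ℝ] C(LatticeSpace, ℝ)}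
    {ν : Measure LatticeSpace} [IsProbabilityMeasure ν]
    (h : ∀ φ : C(LatticeSpace, ℝ), Tendsto (fun n => (Q ^ n) φ) atTop (𝓝 ((∫ x, φ x ∂ν) • 1)))
    (Φ : C(LatticeSpace, ℂ)) :
    TendstoUniformly (fun n : ℕ => ⇑((complexify Q)^[n] Φ)) (fun _ => ∫ x, Φ x ∂ν) atTop := by
  rw [Metric.tendstoUniformly_iff]
  intro ε hε
  filter_upwards [(Metric.tendsto_nhds.1 (h (reMap Φ))) (ε / 2) (half_pos hε),
    (Metric.tendsto_nhds.1 (h (imMap Φ))) (ε / 2) (half_pos hε)] with n h1 h2 x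
  have e : ∫ x, Φ x ∂ν = _ := integral_complexMap ν (reMap Φ) (imMap Φ)
  rw [dist_eq_norm] at h1 h2
  have h3 := (ContinuousMap.norm_coe_le_norm _ x).trans_lt h1
  have h4 := (ContinuousMap.norm_coe_le_norm _ x).trans_lt h2
  rw [complexify_pow_apply, e, dist_comm, dist_eq_norm]
  refine (Complex.norm_le_abs_re_add_abs_im _).trans_lt ?_
  simp at h3 h4 ⊢
  linarith

/-- An eigenfunction of modulus one of an operator whose iterates converge uniformly to constants
is constant. -/
theorem eq_of_tendstoUniformly_iterate {X : Type*} {M : (X → ℂ) → (X → ℂ)} {φ : X → ℂ} {z c : ℂ}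
    (hz : ‖z‖ = 1) (hφ : ∀ n : ℕ, M^[n] φ = z ^ n • φ)
    (h : TendstoUniformly (fun n : ℕ => M^[n] φ) (fun _ => c) atTop) (x y : X) : φ x = φ y := by
  have h1 := ((h.tendsto_at x).sub (h.tendsto_at y)).norm
  -- Since $|z|=1$, iteration leaves the difference between two values unchanged in modulus, while
  -- convergence to a constant sends it to zero.
  have h2 : ∀ n : ℕ, ‖M^[n] φ x - M^[n] φ y‖ = ‖φ x - φ y‖ := fun n => by
    rw [hφ, Pi.smul_apply, Pi.smul_apply, ← smul_sub, norm_smul, norm_pow, hz, one_pow, one_mul]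
  simp only [h2, sub_self, norm_zero] at h1
  exact sub_eq_zero.1 (norm_eq_zero.1 (tendsto_nhds_unique tendsto_const_nhds h1))

theorem mainTheorem7 (S : CoupledLattice) (f : LatticeSpace → ℝ) (hf : S.InC f) :
    -- the operators `P` and `L` are well defined
    (∀ Φ : LatticeSpace → ℂ, S.InC Φ → ∀ x, Tendsto (fun k => S.Pk f k Φ x) atTop (𝓝 (S.P f Φ x))) ∧
    (∃ (lam : ℝ) (ν₀ : Measure LatticeSpace) (h : LatticeSpace → ℝ), S.IsEigendata f lam ν₀ h) ∧
    ∀ (lam : ℝ) (ν₀ : Measure LatticeSpace) (h : LatticeSpace → ℝ), S.IsEigendata f lam ν₀ h →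
      (0 < lam ∧ ∀ x, 0 < h x) ∧
      -- `𝓛` acts on `𝒞`
      (∀ Φ : LatticeSpace → ℂ, S.InC Φ → S.InC (S.calL f lam h Φ)) ∧
      -- the unique continuous extension `Lbar` of `𝓛` to `C(Ω)`
      ∃ Lbar : C(LatticeSpace, ℂ) →L[ℂ] C(LatticeSpace, ℂ),
        (∀ Φ : C(LatticeSpace, ℂ), S.InC Φ → ∀ x, Lbar Φ x = S.calL f lam h Φ x) ∧
        (∀ L' : C(LatticeSpace, ℂ) →L[ℂ] C(LatticeSpace, ℂ),
          (∀ Φ : C(LatticeSpace, ℂ), S.InC Φ → ∀ x, L' Φ x = S.calL f lam h Φ x) → L' = Lbar) ∧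
        -- its dual `Lstar = 𝓛^*` on complex Radon measures is well defined
        ∃ Lstar : ComplexMeasure LatticeSpace →ₗ[ℂ] ComplexMeasure LatticeSpace,
          (∀ (μ : ComplexMeasure LatticeSpace) (φ : C(LatticeSpace, ℂ)),
            complexIntegral (Lstar μ) φ = complexIntegral μ (Lbar φ)) ∧
          (∀ μ μ' : ComplexMeasure LatticeSpace,
            (∀ φ : C(LatticeSpace, ℂ), complexIntegral μ' φ = complexIntegral μ (Lbar φ)) →
              μ' = Lstar μ) ∧
          -- the unique invariant probability measure
          ∃ ν : ProbabilityMeasure LatticeSpace,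
            Lstar (probToComplex ν) = probToComplex ν ∧
            (∀ ν' : ProbabilityMeasure LatticeSpace,
              Lstar (probToComplex ν') = probToComplex ν' → ν' = ν) ∧
            -- `1` is the only eigenvalue of `𝓛` on `𝒞` of modulus one
            {z : ℂ | ‖z‖ = 1 ∧ ∃ φ : LatticeSpace → ℂ, S.InC φ ∧ φ ≠ 0 ∧ S.calL f lam h φ = z • φ} = {1} ∧
            -- `𝓛ⁿ ψ → ∫ ψ dν` uniformly, for `ψ ∈ 𝒞`
            ∀ ψ : LatticeSpace → ℂ, S.InC ψ →
              TendstoUniformly (fun n : ℕ => (S.calL f lam h)^[n] ψ)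
                (fun _ => ∫ x, ψ x ∂(ν : Measure LatticeSpace)) atTop := by
  let F : C(LatticeSpace, ℝ) := ⟨f, hf.1⟩
  have hF : S.InC F := hf
  refine ⟨fun Φ hΦ x => ?_, S.exists_isEigendata hF, fun lam ν₀ h he => ?_⟩
  · have h1 := S.tendsto_Pk F ⟨Φ, hΦ.1⟩ x
    rw [← S.P_eq] at h1
    exact h1
  let H : C(LatticeSpace, ℝ) := ⟨h, he.mem.1⟩
  have hE : S.IsEigendata F lam ν₀ H := he
  obtain ⟨Q, a, a', ha, hQ, h1, hcal⟩ := hE.exists_coupledOp hF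
  replace hcal : ∀ Φ : C(LatticeSpace, ℂ), S.calL f lam h Φ = complexify Q Φ := hcal
  obtain ⟨ν, hν⟩ := hQ.exists_tendsto_integral h1 (S.logCone_dense ha)
  obtain ⟨Lstar, hL⟩ := exists_dual_complexMeasure hQ.pos
  have hconv : ∀ ψ : LatticeSpace → ℂ, S.InC ψ →
      TendstoUniformly (fun n : ℕ => (S.calL f lam h)^[n] ψ)
        (fun _ => ∫ x, ψ x ∂(ν : Measure LatticeSpace)) atTop := fun ψ hψ => by
    have := tendstoUniformly_complexify hν ⟨ψ, hψ.1⟩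
    simp only [← S.iterate_calL_eq hcal] at this
    exact this
  refine ⟨hE.pos, fun Φ hΦ => ?_, complexify Q, fun Φ _ x => (congrFun (hcal Φ) x).symm,
    fun L' hL' => ?_, Lstar, hL, fun μ μ' h => ?_, ν, ?_, fun ν' hν' => ?_, ?_, hconv⟩
  · have := S.inC_complexify ha hQ h1 ⟨Φ, hΦ.1⟩ hΦ
    rw [← hcal] at this
    exact this
  · refine DFunLike.ext' (Continuous.ext_on S.dense_inC L'.continuous (complexify Q).continuous
      fun Φ hΦ => ContinuousMap.ext fun x => ?_)
    rw [hL' Φ hΦ, hcal]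
  · exact complexMeasure_eq_of_complexIntegral_eq fun φ => by rw [h, hL]
  · refine complexMeasure_eq_of_complexIntegral_eq fun φ => ?_
    have e : ∀ φ : LatticeSpace → ℂ, complexIntegral (probToComplex ν) φ =
      ∫ x, φ x ∂(ν : Measure LatticeSpace) := complexIntegral_finiteToComplex _
    have hinv := integral_apply_eq_of_tendsto hν
    rw [hL, e, e, complexify_apply, integral_complexMap, hinv, hinv]
    exact (integral_complexMap (ν : Measure LatticeSpace) (reMap φ) (imMap φ)).symm
  · have key : (ν' : Measure LatticeSpace) = ν := finiteMeasure_eq_of_integral_eq _ _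
      (integral_eq_of_invariant hν _ (integral_eq_of_complexIntegral_eq (ν := ν') fun φ => by
        rw [← hL, hν']))
    exact Subtype.ext key
  · ext z
    rw [mem_singleton_iff]
    constructor
    · rintro ⟨hz, φ, hφ, hne, heq⟩
      have hsm : ∀ n : ℕ, (S.calL f lam h)^[n] φ = z ^ n • φ := fun n => by
        have hc : S.calL f lam h φ = complexify Q ⟨φ, hφ.1⟩ := hcal ⟨φ, hφ.1⟩
        induction n with
        | zero => simp
        | succ n ih =>
          rw [Function.iterate_succ_apply', ih]
          have h2 := hcal (z ^ n • ⟨φ, hφ.1⟩)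
          rw [map_smul] at h2
          refine h2.trans ?_
          rw [ContinuousMap.coe_smul, ← hc, heq, smul_smul, pow_succ]
      have hconst := eq_of_tendstoUniformly_iterate hz hsm (hconv φ hφ)
      -- A constant function is fixed because $\mathcal L1=1$; comparing with $\mathcal
      -- L\varphi=z\varphi$ at a point where $\varphi\ne0$ gives $z=1$.
      have hone : S.calL f lam h φ = φ := by
        have h2 : (⟨φ, hφ.1⟩ : C(LatticeSpace, ℂ)) = φ (fun _ => 0) • complexMap 1 0 := by
          ext x
          rw [ContinuousMap.smul_apply, complexMap_apply, ContinuousMap.coe_mk, hconst x fun _ => 0]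
          exact (mul_one _).symm
        have h3 : complexify Q (complexMap 1 0) = complexMap 1 0 := by
          rw [complexify_apply, show reMap (complexMap (1 : C(LatticeSpace, ℝ)) 0) = 1 from rfl,
            show imMap (complexMap (1 : C(LatticeSpace, ℝ)) 0) = 0 from rfl, h1, map_zero]
        refine (hcal ⟨φ, hφ.1⟩).trans ?_
        rw [h2, map_smul, h3, ← h2]
        rfl
      obtain ⟨x, hx⟩ := Function.ne_iff.1 hne
      have h4 := congrFun (hone.symm.trans heq) x
      exact mul_right_cancel₀ hx (by rw [one_mul]; exact h4.symm)
    · rintro rfl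
      refine ⟨norm_one, complexMap 1 0, S.inC_complexMap ⟨0, le_rfl, fun x y => by simp⟩
        ⟨0, le_rfl, fun x y => by simp⟩, fun h0 => ?_, ?_⟩
      · have := congrArg Complex.re (congrFun h0 fun _ => 0)
        simp at this
      · rw [hcal, complexify_apply, show reMap (complexMap (1 : C(LatticeSpace, ℝ)) 0) = 1 from rfl,
          show imMap (complexMap (1 : C(LatticeSpace, ℝ)) 0) = 0 from rfl, h1, map_zero, one_smul]
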